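/- \textbf{Setting.} A \emph{generalised probabilistic theory} (GPT) is a symmetric monoidal process theory. For all systems $A,B$ the processes $A\to B$ form a closed convex cone $K_A^B$ in a finite-dimensional real vector space $V_A^B$ spanned by it. Sequential and parallel composition are bilinear. States of $A$ form $K^A$ (processes from the trivial system), effects on $A$ form $K_A$ (processes to the trivial system), and numbers (processes from the trivial system to itself) are the nonnegative reals. Two processes $f,g:A\to B$ that yield the same number for all systems $C$, all states of $AC$ and all effects on $BC$ are equal. Each system $A$ has a discarding effect $d_A$, with $d_{AB}=d_A\otimes d_B$ and $d_I=1$ for the trivial system $I$. Write $f\le g$ if $g=f+z$ for some process $z$. A process $f:A\to B$ is \emph{causal} if $d_B\circ f=d_A$ and \emph{subcausal} if $d_B\circ f\le d_A$. Every system has a causal state, and every process is subcausal up to a positive factor. (Given the rest, these two conditions say exactly that every $K_A^B$ has a causal process in its interior.) The GPT is \emph{non-classical} if for some system $A$ the set of causal states is not a simplex. It satisfies the \emph{No-Restriction Hypothesis} if for every $A$ the cone $K_A$ is the whole dual cone of $K^A$, and \emph{Tomographic Locality} if every state of a composite $AB$ is determined by the numbers it gives on product effects $e\otimes f$, with $e\in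 K_A$ and $f\in K_B$. A \emph{bank strategy} on $A$ is a finite family $\mathcal S_A=\{(p_i,s_i,e_i)\}$ with $p_i>0$, $\sum_i p_i=1$, causal states $s_i$ of $A$, and effects $e_i\le d_A$ with $e_i(s_i)=1$. Its counterfeiting value is $$\alpha_A=\sup\Big\{\sum_i p_i\,(e_i\otimes e_i)\big(\chi(s_i)\big)\ :\ \chi\in K_A^{AA}\text{ subcausal}\Big\}.$$ It satisfies \emph{Verification Sharpness} (VS) if for every $i$ and every subcausal state $s$ of $A$ one has $e_i(s)=1\iff s=s_i$. Its ensemble is \emph{classical} if all $s_i$ lie in the convex hull of finitely many causal states $t_1,\dots,t_m$ for which there are effects $f_1,\dots,f_m$ with $\sum_k f_k=d_A$ and $f_k(t_j)=\delta_{jk}$. For $n\ge1$ let $\mathcal S_A^{\otimes n}$ be the bank strategy on $A^{\otimes n}$ formed by $n$ independent copies of $\mathcal S_A$, and $\alpha_{A^{\otimes n}}$ its counterfeiting value. The GPT satisfies \emph{Strong No-Counterfeiting} (SNC) if for every $\delta>0$ there is a bank strategy on some system with counterfeiting value at most $\delta$. \textbf{Statement.} Let a non-classical GPT satisfy the No-Restriction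 Hypothesis and Tomographic Locality, and let $\mathcal S_A$ be a bank strategy in it that satisfies VS. Then the GPT satisfies SNC. Moreover, if the ensemble of $\mathcal S_A$ is not classical, then $\alpha_A<1$ and $\alpha_{A^{\otimes n}}\le\alpha_A^{\,n}$ for all $n\ge1$, so that repetitions of $\mathcal S_A$ itself give unforgeable money. -/

import Mathlib

open CategoryTheory MonoidalCategory

universe v u

/-- A generalised probabilistic theory, presented through the real vector spaces spanned by its
cones of processes. The objects of the symmetric monoidal category `C` are the systems, and
`𝟙_ C` is the trivial system. The hom-space `A ⟶ B` is the real vector space `V_A^B`, and the cone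
`cone A B ⊆ V_A^B` is the set `K_A^B` of (physical) processes from `A` to `B`, by which `V_A^B` is
spanned. Sequential and parallel composition are the bilinear operations of `C`. States of `A` are
the elements of `cone (𝟙_ C) A`, effects on `A` are the elements of `cone A (𝟙_ C)`. -/
structure GPT (C : Type u) [Category.{v} C] [Preadditive C] [Linear ℝ C] [MonoidalCategory C]
    [MonoidalPreadditive C] [MonoidalLinear ℝ C] [SymmetricCategory C] where
  /-- The cone `K_A^B` of processes from `A` to `B`. -/
  cone : ∀ A B : C, PointedCone ℝ (A ⟶ B)
  /-- Processes are closed under being wired together. -/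
  id_mem : ∀ A : C, 𝟙 A ∈ cone A A
  comp_mem : ∀ {A B D : C} (f : A ⟶ B) (g : B ⟶ D),
    f ∈ cone A B → g ∈ cone B D → f ≫ g ∈ cone A D
  tensor_mem : ∀ {A B A' B' : C} (f : A ⟶ B) (g : A' ⟶ B'),
    f ∈ cone A B → g ∈ cone A' B' → (f ⊗ₘ g) ∈ cone (A ⊗ A') (B ⊗ B')
  associator_hom_mem : ∀ A B D : C, (α_ A B D).hom ∈ cone ((A ⊗ B) ⊗ D) (A ⊗ (B ⊗ D))
  associator_inv_mem : ∀ A B D : C, (α_ A B D).inv ∈ cone (A ⊗ (B ⊗ D)) ((A ⊗ B) ⊗ D)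
  leftUnitor_hom_mem : ∀ A : C, (λ_ A).hom ∈ cone (𝟙_ C ⊗ A) A
  leftUnitor_inv_mem : ∀ A : C, (λ_ A).inv ∈ cone A (𝟙_ C ⊗ A)
  rightUnitor_hom_mem : ∀ A : C, (ρ_ A).hom ∈ cone (A ⊗ 𝟙_ C) A
  rightUnitor_inv_mem : ∀ A : C, (ρ_ A).inv ∈ cone A (A ⊗ 𝟙_ C)
  braiding_mem : ∀ A B : C, (β_ A B).hom ∈ cone (A ⊗ B) (B ⊗ A)
  /-- The vector space `V_A^B` is spanned by the processes, it is finite-dimensional, and the cone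
  of processes is closed in it (for the canonical topology of a finite-dimensional space). -/
  span_cone : ∀ A B : C, Submodule.span ℝ (cone A B : Set (A ⟶ B)) = ⊤
  finite : ∀ A B : C, Module.Finite ℝ (A ⟶ B)
  isClosed_cone : ∀ A B : C, @IsClosed _ (moduleTopology ℝ (A ⟶ B)) (cone A B : Set (A ⟶ B))
  /-- Numbers, that is processes from the trivial system to itself, are the nonnegative reals. -/
  num : (𝟙_ C ⟶ 𝟙_ C) ≃ₗ[ℝ] ℝ
  num_id : num (𝟙 (𝟙_ C)) = 1
  mem_cone_unit : ∀ x : 𝟙_ C ⟶ 𝟙_ C, x ∈ cone (𝟙_ C) (𝟙_ C) ↔ 0 ≤ num x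
  /-- Tomography: processes that give the same numbers in all situations are equal. -/
  tomography : ∀ {A B : C} (f g : A ⟶ B), f ∈ cone A B → g ∈ cone A B →
    (∀ (D : C) (s : 𝟙_ C ⟶ A ⊗ D) (e : B ⊗ D ⟶ 𝟙_ C),
      s ∈ cone (𝟙_ C) (A ⊗ D) → e ∈ cone (B ⊗ D) (𝟙_ C) →
      num (s ≫ (f ▷ D) ≫ e) = num (s ≫ (g ▷ D) ≫ e)) → f = g
  /-- The discarding effects. -/
  discard : ∀ A : C, A ⟶ 𝟙_ C
  discard_mem : ∀ A : C, discard A ∈ cone A (𝟙_ C)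
  discard_unit : discard (𝟙_ C) = 𝟙 (𝟙_ C)
  discard_tensor : ∀ A B : C,
    discard (A ⊗ B) = (discard A ⊗ₘ discard B) ≫ (λ_ (𝟙_ C)).hom
  /-- Every system has a causal state. -/
  exists_causal_state : ∀ A : C, ∃ s ∈ cone (𝟙_ C) A, s ≫ discard A = 𝟙 (𝟙_ C)
  /-- Every process is subcausal up to a positive factor. -/
  exists_subcausal_smul : ∀ {A B : C} (f : A ⟶ B), f ∈ cone A B →
    ∃ r : ℝ, 0 < r ∧ discard A - (r • f) ≫ discard B ∈ cone A (𝟙_ C)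

namespace GPT

section Tensor

variable {C : Type u} [Category.{v} C] [MonoidalCategory C] {A B : C}

/-- The parallel composite of two states, as a state of the composite system. -/
def tensorState (s : 𝟙_ C ⟶ A) (t : 𝟙_ C ⟶ B) : 𝟙_ C ⟶ A ⊗ B :=
  (λ_ (𝟙_ C)).inv ≫ (s ⊗ₘ t)

/-- The parallel composite of two effects, as an effect on the composite system. -/
def tensorEffect (e : A ⟶ 𝟙_ C) (f : B ⟶ 𝟙_ C) : A ⊗ B ⟶ 𝟙_ C :=
  (e ⊗ₘ f) ≫ (λ_ (𝟙_ C)).hom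

lemma tensorState_comp_tensorEffect (s : 𝟙_ C ⟶ A) (t : 𝟙_ C ⟶ B) (e : A ⟶ 𝟙_ C)
    (f : B ⟶ 𝟙_ C) : tensorState s t ≫ tensorEffect e f = (t ≫ f) ≫ (s ≫ e) := by
  simp only [tensorState, tensorEffect, Category.assoc]
  rw [← Category.assoc (s ⊗ₘ t), tensorHom_comp_tensorHom, tensorHom_def',
    Category.assoc, unitors_equal, rightUnitor_naturality, ← unitors_equal,
    leftUnitor_naturality_assoc, Iso.inv_hom_id_assoc, Category.assoc]

end Tensor

variable {C : Type u} [Category.{v} C] [Preadditive C] [Linear ℝ C] [MonoidalCategory C]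
  [MonoidalPreadditive C] [MonoidalLinear ℝ C] [SymmetricCategory C] (T : GPT C)

/-- The order of processes: `f ≤ g` if `f + z = g` for some process `z`. -/
def Le {A B : C} (f g : A ⟶ B) : Prop :=
  ∃ z ∈ T.cone A B, f + z = g

/-- Causal processes: discarding the output amounts to discarding the input. -/
def IsCausal {A B : C} (f : A ⟶ B) : Prop :=
  f ∈ T.cone A B ∧ f ≫ T.discard B = T.discard A

/-- Subcausal processes. -/
def IsSubcausal {A B : C} (f : A ⟶ B) : Prop :=
  f ∈ T.cone A B ∧ T.Le (f ≫ T.discard B) (T.discard A)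

/-- The convex set of causal states of a system. -/
def causalStates (A : C) : Set (𝟙_ C ⟶ A) :=
  {s | T.IsCausal s}

/-- A system is classical if its causal states form a simplex. -/
def IsClassicalSystem (A : C) : Prop :=
  ∃ (n : ℕ) (t : Fin n → (𝟙_ C ⟶ A)),
    AffineIndependent ℝ t ∧ T.causalStates A = convexHull ℝ (Set.range t)

/-- A theory is non-classical if some system is not classical. -/
def NonClassical : Prop :=
  ∃ A : C, ¬ T.IsClassicalSystem A

/-- The No-Restriction Hypothesis: the cone of effects on `A` is the whole dual of the cone of
states of `A`. -/
def NoRestriction : Prop :=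
  ∀ (A : C) (φ : (𝟙_ C ⟶ A) →ₗ[ℝ] ℝ), (∀ s ∈ T.cone (𝟙_ C) A, 0 ≤ φ s) →
    ∃ e ∈ T.cone A (𝟙_ C), ∀ s : 𝟙_ C ⟶ A, T.num (s ≫ e) = φ s

/-- Tomographic Locality: a state of a composite system is determined by the numbers that local
effects give on it. -/
def TomographicLocality : Prop :=
  ∀ (A B : C), ∀ s ∈ T.cone (𝟙_ C) (A ⊗ B), ∀ t ∈ T.cone (𝟙_ C) (A ⊗ B),
    (∀ e ∈ T.cone A (𝟙_ C), ∀ f ∈ T.cone B (𝟙_ C),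
      T.num (s ≫ tensorEffect e f) = T.num (t ≫ tensorEffect e f)) → s = t

/-- A bank strategy on the system `A`: with probability `p i` the bank prepares the causal state
`s i`, which it verifies by the subcausal effect `e i`, which accepts `s i` with certainty. -/
structure BankStrategy (A : C) where
  ι : Type
  [fintype : Fintype ι]
  p : ι → ℝ
  s : ι → (𝟙_ C ⟶ A)
  e : ι → (A ⟶ 𝟙_ C)
  p_pos : ∀ i, 0 < p i
  p_sum : ∑ i, p i = 1
  s_causal : ∀ i, T.IsCausal (s i)
  e_mem : ∀ i, e i ∈ T.cone A (𝟙_ C)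
  e_le : ∀ i, T.Le (e i) (T.discard A)
  accept : ∀ i, T.num (s i ≫ e i) = 1

attribute [instance] BankStrategy.fintype

/-- The physical counterfeiting machines: subcausal processes from `A` to `A ⊗ A`. -/
def counterfeiters (A : C) : Set (A ⟶ A ⊗ A) :=
  {χ | T.IsSubcausal χ}

/-- The probability that both outputs of the
counterfeiting machine `χ` pass the verification. -/
def BankStrategy.successProb {T : GPT C} {A : C} (S : T.BankStrategy A) (χ : A ⟶ A ⊗ A) : ℝ :=
  ∑ i, S.p i * T.num (S.s i ≫ χ ≫ tensorEffect (S.e i) (S.e i))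

/-- The optimal counterfeiting probability `α_A` of a bank strategy. -/
noncomputable def BankStrategy.alpha {T : GPT C} {A : C} (S : T.BankStrategy A) : ℝ :=
  sSup (S.successProb '' T.counterfeiters A)

/-- Verification Sharpness: among the subcausal states, `e i` accepts with certainty exactly the
state `s i`. -/
def BankStrategy.VerificationSharp {T : GPT C} {A : C} (S : T.BankStrategy A) : Prop :=
  ∀ i, ∀ s : 𝟙_ C ⟶ A, T.IsSubcausal s → (T.num (s ≫ S.e i) = 1 ↔ s = S.s i)

/-- The ensemble of a bank strategy is classical if its states lie in a simplex whose vertices are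
causal states that a single measurement distinguishes perfectly. -/
def BankStrategy.ClassicalEnsemble {T : GPT C} {A : C} (S : T.BankStrategy A) : Prop :=
  ∃ (n : ℕ) (t : Fin n → (𝟙_ C ⟶ A)) (f : Fin n → (A ⟶ 𝟙_ C)),
    (∀ j, T.IsCausal (t j)) ∧ (∀ j, f j ∈ T.cone A (𝟙_ C)) ∧ ∑ j, f j = T.discard A ∧
    (∀ j k, T.num (t j ≫ f k) = if j = k then 1 else 0) ∧
    ∀ i, S.s i ∈ convexHull ℝ (Set.range t)

/-- Strong No-Counterfeiting: unforgeable money exists. -/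
def SNC : Prop :=
  ∀ δ : ℝ, 0 < δ → ∃ (A : C) (S : T.BankStrategy A), S.alpha ≤ δ

section Product

variable {A B : C}

lemma eq_num_smul (x : 𝟙_ C ⟶ 𝟙_ C) : x = T.num x • 𝟙 (𝟙_ C) := by
  apply T.num.injective
  rw [map_smul, T.num_id, smul_eq_mul, mul_one]

lemma num_comp (x y : 𝟙_ C ⟶ 𝟙_ C) : T.num (x ≫ y) = T.num x * T.num y := by
  conv_lhs => rw [T.eq_num_smul x]
  rw [Linear.smul_comp, Category.id_comp, map_smul, smul_eq_mul]

lemma discard_tensor' (A B : C) :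
    T.discard (A ⊗ B) = tensorEffect (T.discard A) (T.discard B) :=
  T.discard_tensor A B

lemma tensorEffect_mem {e : A ⟶ 𝟙_ C} {f : B ⟶ 𝟙_ C} (he : e ∈ T.cone A (𝟙_ C))
    (hf : f ∈ T.cone B (𝟙_ C)) : tensorEffect e f ∈ T.cone (A ⊗ B) (𝟙_ C) :=
  T.comp_mem _ _ (T.tensor_mem _ _ he hf) (T.leftUnitor_hom_mem _)

lemma tensorState_isCausal {s : 𝟙_ C ⟶ A} {t : 𝟙_ C ⟶ B} (hs : T.IsCausal s)
    (ht : T.IsCausal t) : T.IsCausal (tensorState s t) := by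
  refine ⟨T.comp_mem _ _ (T.leftUnitor_inv_mem _) (T.tensor_mem _ _ hs.1 ht.1), ?_⟩
  rw [T.discard_tensor', tensorState_comp_tensorEffect, hs.2, ht.2, T.discard_unit,
    Category.comp_id]

lemma tensorEffect_le {e : A ⟶ 𝟙_ C} {f : B ⟶ 𝟙_ C} (he : e ∈ T.cone A (𝟙_ C))
    (he' : T.Le e (T.discard A)) (hf' : T.Le f (T.discard B)) :
    T.Le (tensorEffect e f) (T.discard (A ⊗ B)) := by
  obtain ⟨z, hz, hez⟩ := he'
  obtain ⟨w, hw, hfw⟩ := hf'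
  refine ⟨tensorEffect e w + tensorEffect z (T.discard B),
    add_mem (T.tensorEffect_mem he hw) (T.tensorEffect_mem hz (T.discard_mem B)), ?_⟩
  rw [T.discard_tensor', ← hez, ← hfw]
  simp only [tensorEffect, MonoidalPreadditive.tensor_add, MonoidalPreadditive.add_tensor,
    Preadditive.add_comp]
  abel

/-- The product of two bank strategies: the bank samples independently from both. -/
def BankStrategy.prod {T : GPT C} (S : T.BankStrategy A) (S' : T.BankStrategy B) :
    T.BankStrategy (A ⊗ B) where
  ι := S.ι × S'.ι
  p := fun i => S.p i.1 * S'.p i.2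
  s := fun i => tensorState (S.s i.1) (S'.s i.2)
  e := fun i => tensorEffect (S.e i.1) (S'.e i.2)
  p_pos := fun i => mul_pos (S.p_pos i.1) (S'.p_pos i.2)
  p_sum := by rw [Fintype.sum_prod_type, ← Fintype.sum_mul_sum, S.p_sum, S'.p_sum, one_mul]
  s_causal := fun i => T.tensorState_isCausal (S.s_causal i.1) (S'.s_causal i.2)
  e_mem := fun i => T.tensorEffect_mem (S.e_mem i.1) (S'.e_mem i.2)
  e_le := fun i => T.tensorEffect_le (S.e_mem i.1) (S.e_le i.1) (S'.e_le i.2)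
  accept := fun i => by
    rw [tensorState_comp_tensorEffect, T.num_comp, S.accept, S'.accept, one_mul]

/-- The composite of `n + 1` copies of a system. -/
def tensorPow (A : C) : ℕ → C
  | 0 => A
  | n + 1 => tensorPow A n ⊗ A

/-- The bank strategy that puts `n + 1` independent copies of a strategy on each banknote. -/
def BankStrategy.copies {T : GPT C} (S : T.BankStrategy A) :
    (n : ℕ) → T.BankStrategy (tensorPow A n)
  | 0 => S
  | n + 1 => (S.copies n).prod S

end Product

end GPT

/-!
Under the No-Restriction Hypothesis a state is the same as a functional that is nonnegative on
effects, so conic duality turns the optimal counterfeiting probability `α` of a bank strategy into a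
state `σ` of total weight `α` such that discarding the outputs of any machine run on `σ` succeeds at
least as well as counterfeiting with it. Tensor products of such certificates are certificates for
product strategies, hence `α` is submultiplicative, and `α < 1` suffices for unforgeable money.

If `α = 1`, then by compactness some machine counterfeits perfectly. Verification Sharpness forces
the outputs on each `s i` to be two independent copies of `s i` as far as product effects can tell.
Repeated cloning amplifies the effects `e i` until they separate the states perfectly, and testing
for one state after another on fresh clones is a measurement that distinguishes them all: the
ensemble is classical.

In a non-classical system the exposed states are not finitely many linearly independent ones, since
by Straszewicz's theorem they generate all causal states. Each exposed state has a sharp effect, so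
the uniform strategy on suitable finitely many exposed states satisfies Verification Sharpness,
while its ensemble is not classical.
-/

section Exposed

variable {E : Type*} [NormedAddCommGroup E] [InnerProductSpace ℝ E] {S F : Set E}

lemma mem_exposedPoints_of_isMaxOn_dist {c y : E} (hy : y ∈ S) (hmax : IsMaxOn (dist · c) S y) :
    y ∈ S.exposedPoints ℝ := by
  have hexp (t : E) (ht : t ∈ S) : ‖t - y‖ ^ 2 ≤ 2 * (inner ℝ (y - c) y - inner ℝ (y - c) t) := by
    have hle : ‖t - c‖ ^ 2 ≤ ‖y - c‖ ^ 2 := by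
      gcongr
      simpa only [dist_eq_norm, Set.mem_ofPred_eq] using hmax ht
    rw [← sub_add_sub_cancel t y c, norm_add_sq_real, real_inner_comm, inner_sub_right] at hle
    linarith
  refine ⟨hy, innerSL ℝ (y - c), fun t ht => ?_⟩
  simp only [innerSL_apply_apply]
  refine ⟨by nlinarith [hexp t ht, sq_nonneg ‖t - y‖], fun hle => ?_⟩
  have : ‖t - y‖ ^ 2 = 0 := le_antisymm (by linarith [hexp t ht]) (sq_nonneg _)
  rwa [sq_eq_zero_iff, norm_eq_zero, sub_eq_zero] at this

/-- The center is `x - R • w` for large `R`: there, `dist x c = R * ‖w‖` to leading order, and the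
strict separation gains a multiple of `R` over the bounded error `‖y - x‖ ^ 2`. -/
lemma exists_center_of_inner_lt (hF : Bornology.IsBounded F) {x w : E} {u : ℝ}
    (hFu : ∀ y ∈ F, inner ℝ w y ≤ u) (hux : u < inner ℝ w x) :
    ∃ c, ∀ y ∈ F, dist y c < dist x c := by
  obtain ⟨b, hb⟩ := hF.exists_norm_le
  set R := ((b + ‖x‖) ^ 2 + 1) / (inner ℝ w x - u)
  have hgap : 0 < inner ℝ w x - u := sub_pos.2 hux
  have : 0 < R := by positivity
  refine ⟨x - R • w, fun y hy => ?_⟩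
  have hyx : ‖y - x‖ ^ 2 ≤ (b + ‖x‖) ^ 2 := by
    gcongr
    exact (norm_sub_le y x).trans (by gcongr; exact hb y hy)
  have hRgap : R * (inner ℝ w x - u) = (b + ‖x‖) ^ 2 + 1 := div_mul_cancel₀ _ hgap.ne'
  have hsep : R * inner ℝ w y ≤ R * u := by gcongr; exact hFu y hy
  rw [dist_eq_norm, dist_eq_norm, sub_sub_cancel]
  refine lt_of_pow_lt_pow_left₀ 2 (norm_nonneg _) ?_
  rw [← sub_add, norm_add_sq_real, inner_smul_right, inner_sub_left, real_inner_comm w,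
    real_inner_comm w, mul_sub]
  rw [mul_sub] at hRgap
  linarith [sq_nonneg (b + ‖x‖)]

/-- **Straszewicz's theorem**. If `x` is separated from the exposed points, then a point of `S` that
is farthest from a suitable center is an exposed point that is farther away than all of them. -/
theorem subset_closedConvexHull_exposedPoints [CompleteSpace E] (hS : IsCompact S) :
    S ⊆ closedConvexHull ℝ (S.exposedPoints ℝ) := by
  intro x hx
  by_contra hxS
  obtain ⟨f, u, hfu, hux⟩ := geometric_hahn_banach_closed_point convex_closedConvexHull
    isClosed_closedConvexHull hxS
  obtain ⟨w, rfl⟩ := (InnerProductSpace.toDual ℝ E).surjective f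
  obtain ⟨c, hc⟩ := exists_center_of_inner_lt (hS.isBounded.subset exposedPoints_subset)
    (fun y hy => (hfu y (subset_closedConvexHull hy)).le) hux
  obtain ⟨y, hy, hmax⟩ := hS.exists_isMaxOn ⟨x, hx⟩
    (continuous_id.dist (continuous_const (y := c))).continuousOn
  exact (hc y (mem_exposedPoints_of_isMaxOn_dist hy hmax)).not_ge (hmax hx)

end Exposed

section FiniteDimensional

lemma image_exposedPoints {𝕜 V W : Type*} [TopologicalSpace 𝕜] [Ring 𝕜] [PartialOrder 𝕜]
    [AddCommMonoid V] [TopologicalSpace V] [Module 𝕜 V]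
    [AddCommMonoid W] [TopologicalSpace W] [Module 𝕜 W] (L : V ≃L[𝕜] W) (S : Set V) :
    L '' S.exposedPoints 𝕜 = (L '' S).exposedPoints 𝕜 := by
  ext y
  constructor
  · rintro ⟨x, ⟨hx, l, hl⟩, rfl⟩
    refine ⟨Set.mem_image_of_mem L hx, l.comp L.symm.toContinuousLinearMap, ?_⟩
    rintro _ ⟨t, ht, rfl⟩
    simpa using hl t ht
  · rintro ⟨⟨x, hx, rfl⟩, l, hl⟩
    refine ⟨x, ⟨hx, l.comp L.toContinuousLinearMap, fun t ht => ?_⟩, rfl⟩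
    simpa using hl (L t) (Set.mem_image_of_mem L ht)

variable {V : Type*} [AddCommGroup V] [Module ℝ V] [TopologicalSpace V]

lemma t2Space_of_isModuleTopology [IsModuleTopology ℝ V] [FiniteDimensional ℝ V] : T2Space V :=
  T2Space.of_injective_continuous (Module.finBasis ℝ V).equivFun.injective
    (IsModuleTopology.continuous_of_linearMap (Module.finBasis ℝ V).equivFun.toLinearMap)

variable [IsTopologicalAddGroup V] [ContinuousSMul ℝ V]

lemma mem_of_forall_add_smul_mem {K : PointedCone ℝ V} (hK : IsClosed (K : Set V)) {x v : V}
    (h : ∀ r : ℝ, 0 ≤ r → x + r • v ∈ K) : v ∈ K := by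
  have hlim : Filter.Tendsto (fun r : ℝ => r⁻¹ • x + v) Filter.atTop (nhds v) := by
    simpa using (tendsto_inv_atTop_zero (𝕜 := ℝ) |>.smul_const x).add_const v
  refine hK.mem_of_tendsto hlim ?_
  filter_upwards [Filter.eventually_gt_atTop 0] with r hr
  have := K.smul_mem (inv_nonneg.2 hr.le) (h r hr.le)
  rwa [smul_add, inv_smul_smul₀ hr.ne'] at this

variable [T2Space V] [FiniteDimensional ℝ V]

lemma locallyConvexSpace_of_finiteDimensional : LocallyConvexSpace ℝ V := by
  let L : V ≃L[ℝ] _ := toEuclidean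
  rw [L.toHomeomorph.isInducing.eq_induced]
  exact LocallyConvexSpace.induced L.toLinearMap

lemma isCompact_of_forall_ray_trivial {S : Set V} (hclosed : IsClosed S) (hconv : Convex ℝ S)
    (hray : ∀ x ∈ S, ∀ v, (∀ r : ℝ, 0 ≤ r → x + r • v ∈ S) → v = 0) : IsCompact S := by
  let L : V ≃L[ℝ] _ := toEuclidean
  have hLclosed : IsClosed (L '' S) := L.toHomeomorph.isClosedMap S hclosed
  suffices IsCompact (L '' S) from L.toHomeomorph.isCompact_image.1 this
  refine Metric.isCompact_of_isClosed_isBounded hLclosed ?_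
  rw [isBounded_iff_asymptoticCone_subset_singleton]
  intro v hv
  obtain rfl | ⟨x, hx⟩ := S.eq_empty_or_nonempty
  · simp at hv
  refine L.symm.map_eq_zero_iff.1 (hray x hx _ fun r hr => ?_)
  obtain ⟨y, hy, hyx⟩ := (hconv.linear_image L.toLinearMap
    ).smul_vadd_mem_of_isClosed_of_mem_asymptoticCone hLclosed hr hv (Set.mem_image_of_mem L hx)
  have : y = x + r • L.symm v := L.injective (by
    simpa [add_comm] using hyx)
  exact this ▸ hy

theorem subset_convexHull_exposedPoints {S : Set V} (hS : IsCompact S)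
    (hfin : (S.exposedPoints ℝ).Finite) : S ⊆ convexHull ℝ (S.exposedPoints ℝ) := by
  let L : V ≃L[ℝ] _ := toEuclidean
  have h := subset_closedConvexHull_exposedPoints (hS.image L.continuous)
  rw [← image_exposedPoints L, closedConvexHull_eq_closure_convexHull,
    ((hfin.image L).isClosed_convexHull ℝ).closure_eq] at h
  have himage := L.toLinearMap.image_convexHull (S.exposedPoints ℝ)
  exact (Set.image_subset_image_iff L.injective).1 (h.trans_eq himage.symm)

end FiniteDimensional

section Cone

lemma exists_mem_mem_eq_sub_of_span_eq_top {V : Type*} [AddCommGroup V] [Module ℝ V]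
    {K : PointedCone ℝ V} (hK : Submodule.span ℝ (K : Set V) = ⊤) (x : V) :
    ∃ a ∈ K, ∃ b ∈ K, x = a - b := by
  cases subsingleton_or_nontrivial V
  · exact ⟨0, zero_mem K, 0, zero_mem K, Subsingleton.elim _ _⟩
  · have hrep : (K : ConvexCone ℝ V).IsReproducing := .of_span_eq_top hK
    obtain ⟨a, ha, b, hb, hab⟩ := hrep.sub_eq_univ.ge (Set.mem_univ x)
    exact ⟨a, ha, b, hb, hab.symm⟩

variable {V E : Type*} [AddCommGroup V] [Module ℝ V] [AddCommGroup E] [Module ℝ E]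

/-- The hypograph of the value function of the conic program that maximises `Φ x` over all `x ∈ K`
with `e - δ x ∈ P`, where the bound `e` varies. -/
def conicHypograph (K : PointedCone ℝ V) (P : PointedCone ℝ E) (δ : V →ₗ[ℝ] E) (Φ : V →ₗ[ℝ] ℝ) :
    PointedCone ℝ (E × ℝ) where
  carrier := {q | ∃ x ∈ K, q.1 - δ x ∈ P ∧ q.2 ≤ Φ x}
  zero_mem' := ⟨0, zero_mem _, by simp, by simp⟩
  add_mem' := by
    rintro q q' ⟨x, hx, hq, ht⟩ ⟨x', hx', hq', ht'⟩
    refine ⟨x + x', add_mem hx hx', ?_, ?_⟩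
    · simpa only [sub_add_sub_comm, ← map_add, Prod.fst_add] using add_mem hq hq'
    · rw [map_add]
      exact add_le_add ht ht'
  smul_mem' := by
    rintro ⟨c, hc⟩ q ⟨x, hx, hq, ht⟩
    refine ⟨c • x, K.smul_mem hc hx, ?_, ?_⟩
    · rw [map_smul]
      exact (smul_sub c q.1 (δ x)) ▸ P.smul_mem hc hq
    · rw [map_smul]
      exact mul_le_mul_of_nonneg_left ht hc

/-- The functional `(r • d, t) ↦ r * α - t` is nonnegative on the hypograph of the value function,
where it is defined, so the Riesz extension theorem applies to it. -/
lemma exists_conic_dual {K : PointedCone ℝ V} {P : PointedCone ℝ E} {δ : V →ₗ[ℝ] E} {d : E}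
    {Φ : V →ₗ[ℝ] ℝ} {α : ℝ} (hd : ∀ e, ∃ r : ℝ, e + r • d ∈ P)
    (hα : ∀ x ∈ K, ∀ r : ℝ, r • d - δ x ∈ P → Φ x ≤ r * α) :
    ∃ σ : E →ₗ[ℝ] ℝ, (∀ e ∈ P, 0 ≤ σ e) ∧ σ d = α ∧ ∀ x ∈ K, Φ x ≤ σ (δ x) := by
  have hdα : ∀ r : ℝ, r • d = 0 → r • α = 0 := fun r hr =>
    le_antisymm (by simpa [hr] using hα 0 (zero_mem K) (-r))
      (by simpa [hr] using hα 0 (zero_mem K) r)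
  let f : E × ℝ →ₗ.[ℝ] ℝ :=
    (LinearPMap.mkSpanSingleton' d α hdα).coprod ((-LinearMap.id : ℝ →ₗ[ℝ] ℝ).toPMap ⊤)
  have hmem (r t : ℝ) : (r • d, t) ∈ f.domain := ⟨Submodule.mem_span_singleton.2 ⟨r, rfl⟩, trivial⟩
  have hf (r t : ℝ) (h : (r • d, t) ∈ f.domain) : f ⟨(r • d, t), h⟩ = r * α - t := by
    have : LinearPMap.mkSpanSingleton' d α hdα ⟨r • d, h.1⟩ = r • α :=
      LinearPMap.mkSpanSingleton'_apply _ _ _ _ _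
    exact (congrArg (· + -t) this).trans (sub_eq_add_neg _ _).symm
  obtain ⟨g, hgf, hg⟩ := riesz_extension (conicHypograph K P δ Φ) f
    (by
      rintro ⟨⟨e, t⟩, he⟩ ⟨x, hx, hex, hxt⟩
      obtain ⟨r, rfl⟩ := Submodule.mem_span_singleton.1 he.1
      rw [hf, sub_nonneg]
      exact hxt.trans (hα x hx r hex))
    (by
      rintro ⟨e, t⟩
      obtain ⟨r, hr⟩ := hd e
      exact ⟨⟨_, hmem r (-t)⟩, 0, zero_mem _, by simpa [add_comm] using hr, by simp⟩)
  have hgd (r t : ℝ) : g (r • d, t) = r * α - t := (hgf ⟨_, hmem r t⟩).trans (hf r t _)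
  refine ⟨g ∘ₗ LinearMap.inl ℝ E ℝ, fun e he => hg _ ⟨0, zero_mem _, by simpa using he, by simp⟩,
    by simpa using hgd 1 0, fun x hx => ?_⟩
  have hgx : 0 ≤ g (δ x, Φ x) := hg _ ⟨x, hx, by simp, le_rfl⟩
  have hsplit : ((δ x, Φ x) : E × ℝ) = (δ x, 0) + ((0 : ℝ) • d, Φ x) := by simp
  rw [hsplit, map_add, hgd, zero_mul, zero_sub] at hgx
  exact le_of_sub_nonneg hgx

end Cone

namespace GPT

section Contraction

variable {C : Type u} [Category.{v} C] [MonoidalCategory C] {A B X Y : C}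

lemma whiskerLeft_comp_rightUnitor_comp (e : A ⟶ 𝟙_ C) (f : B ⟶ 𝟙_ C) :
    A ◁ f ≫ (ρ_ A).hom ≫ e = tensorEffect e f := by
  rw [tensorEffect, tensorHom_def', Category.assoc, unitors_equal, rightUnitor_naturality]

lemma whiskerRight_comp_leftUnitor_comp (e : A ⟶ 𝟙_ C) (f : B ⟶ 𝟙_ C) :
    e ▷ B ≫ (λ_ B).hom ≫ f = tensorEffect e f := by
  rw [tensorEffect, MonoidalCategory.tensorHom_def, Category.assoc, leftUnitor_naturality]

lemma comp_rightUnitor_inv_comp_whiskerLeft (s : 𝟙_ C ⟶ A) (t : 𝟙_ C ⟶ B) :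
    s ≫ (ρ_ A).inv ≫ A ◁ t = tensorState s t := by
  rw [tensorState, MonoidalCategory.tensorHom_def, unitors_inv_equal,
    rightUnitor_inv_naturality_assoc]

lemma comp_leftUnitor_inv_comp_whiskerRight (s : 𝟙_ C ⟶ A) (t : 𝟙_ C ⟶ B) :
    t ≫ (λ_ B).inv ≫ s ▷ B = tensorState s t := by
  rw [tensorState, tensorHom_def', leftUnitor_inv_naturality_assoc]

/-- The effect `f` applied to the second factor of the output of a process. -/
def contractRight (χ : X ⟶ A ⊗ B) (f : B ⟶ 𝟙_ C) : X ⟶ A :=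
  χ ≫ A ◁ f ≫ (ρ_ A).hom

/-- The effect `e` applied to the first factor of the output of a process. -/
def contractLeft (χ : X ⟶ A ⊗ B) (e : A ⟶ 𝟙_ C) : X ⟶ B :=
  χ ≫ e ▷ B ≫ (λ_ B).hom

/-- The state `t` inserted into the second factor of the input of a process. -/
def insertRight (χ : A ⊗ B ⟶ X) (t : 𝟙_ C ⟶ B) : A ⟶ X :=
  (ρ_ A).inv ≫ A ◁ t ≫ χ

/-- The state `s` inserted into the first factor of the input of a process. -/
def insertLeft (χ : A ⊗ B ⟶ X) (s : 𝟙_ C ⟶ A) : B ⟶ X :=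
  (λ_ B).inv ≫ s ▷ B ≫ χ

@[simp]
lemma contractRight_comp (χ : X ⟶ A ⊗ B) (f : B ⟶ 𝟙_ C) (e : A ⟶ 𝟙_ C) :
    contractRight χ f ≫ e = χ ≫ tensorEffect e f := by
  simp only [contractRight, Category.assoc, whiskerLeft_comp_rightUnitor_comp]

@[simp]
lemma contractLeft_comp (χ : X ⟶ A ⊗ B) (e : A ⟶ 𝟙_ C) (f : B ⟶ 𝟙_ C) :
    contractLeft χ e ≫ f = χ ≫ tensorEffect e f := by
  simp only [contractLeft, Category.assoc, whiskerRight_comp_leftUnitor_comp]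

lemma comp_insertRight_comp (χ : A ⊗ B ⟶ X) (t : 𝟙_ C ⟶ B) (s : 𝟙_ C ⟶ A) (f : X ⟶ Y) :
    s ≫ insertRight χ t ≫ f = tensorState s t ≫ χ ≫ f := by
  simp only [insertRight, Category.assoc, ← comp_rightUnitor_inv_comp_whiskerLeft]

lemma comp_insertLeft_comp (χ : A ⊗ B ⟶ X) (s : 𝟙_ C ⟶ A) (t : 𝟙_ C ⟶ B) (f : X ⟶ Y) :
    t ≫ insertLeft χ s ≫ f = tensorState s t ≫ χ ≫ f := by
  simp only [insertLeft, Category.assoc, ← comp_leftUnitor_inv_comp_whiskerRight]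

/-- A process between composite systems as a process between their first factors, given a state `t`
of the second input and an effect `f` on the second output. -/
def sliceLeft (ψ : A ⊗ B ⟶ X ⊗ Y) (t : 𝟙_ C ⟶ B) (f : Y ⟶ 𝟙_ C) : A ⟶ X :=
  contractRight (insertRight ψ t) f

/-- A process between composite systems as a process between their second factors, given a state `s`
of the first input and an effect `e` on the first output. -/
def sliceRight (ψ : A ⊗ B ⟶ X ⊗ Y) (s : 𝟙_ C ⟶ A) (e : X ⟶ 𝟙_ C) : B ⟶ Y :=
  contractLeft (insertLeft ψ s) e

lemma comp_sliceLeft_comp (ψ : A ⊗ B ⟶ X ⊗ Y) (s : 𝟙_ C ⟶ A) (t : 𝟙_ C ⟶ B) (e : X ⟶ 𝟙_ C)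
    (f : Y ⟶ 𝟙_ C) : s ≫ sliceLeft ψ t f ≫ e = tensorState s t ≫ ψ ≫ tensorEffect e f := by
  rw [sliceLeft, contractRight_comp, comp_insertRight_comp]

lemma comp_sliceRight_comp (ψ : A ⊗ B ⟶ X ⊗ Y) (s : 𝟙_ C ⟶ A) (t : 𝟙_ C ⟶ B) (e : X ⟶ 𝟙_ C)
    (f : Y ⟶ 𝟙_ C) : t ≫ sliceRight ψ s e ≫ f = tensorState s t ≫ ψ ≫ tensorEffect e f := by
  rw [sliceRight, contractLeft_comp, comp_insertLeft_comp]

end Contraction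

lemma tensorμ_comp_tensorEffect {C : Type u} [Category.{v} C] [MonoidalCategory C]
    [BraidedCategory C] {X₁ X₂ Y₁ Y₂ : C} (e₁ : X₁ ⟶ 𝟙_ C) (e₂ : X₂ ⟶ 𝟙_ C)
    (f₁ : Y₁ ⟶ 𝟙_ C) (f₂ : Y₂ ⟶ 𝟙_ C) :
    tensorμ X₁ X₂ Y₁ Y₂ ≫ tensorEffect (tensorEffect e₁ f₁) (tensorEffect e₂ f₂) =
      tensorEffect (tensorEffect e₁ e₂) (tensorEffect f₁ f₂) := by
  simp only [tensorEffect, ← tensorHom_comp_tensorHom, Category.assoc]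
  have h : ((λ_ (𝟙_ C)).hom ⊗ₘ (λ_ (𝟙_ C)).hom) ≫ (λ_ (𝟙_ C)).hom =
      (λ_ (𝟙_ C)).hom ▷ (𝟙_ C ⊗ 𝟙_ C) ≫ (λ_ (𝟙_ C ⊗ 𝟙_ C)).hom ≫ (λ_ (𝟙_ C)).hom := by monoidal
  rw [← tensorμ_natural_assoc, h, ← leftUnitor_monoidal_assoc, h]

section Linear

variable {C : Type u} [Category.{v} C] [Preadditive C] [MonoidalCategory C]
  [MonoidalPreadditive C] {A B : C}

lemma tensorEffect_add_right (e : A ⟶ 𝟙_ C) (f g : B ⟶ 𝟙_ C) :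
    tensorEffect e (f + g) = tensorEffect e f + tensorEffect e g := by
  simp only [tensorEffect, MonoidalPreadditive.tensor_add, Preadditive.add_comp]

lemma tensorEffect_add_left (e f : A ⟶ 𝟙_ C) (g : B ⟶ 𝟙_ C) :
    tensorEffect (e + f) g = tensorEffect e g + tensorEffect f g := by
  simp only [tensorEffect, MonoidalPreadditive.add_tensor, Preadditive.add_comp]

lemma tensorEffect_sub_right (e : A ⟶ 𝟙_ C) (f g : B ⟶ 𝟙_ C) :
    tensorEffect e (f - g) = tensorEffect e f - tensorEffect e g := by
  rw [eq_sub_iff_add_eq, ← tensorEffect_add_right, sub_add_cancel]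

lemma tensorEffect_sub_left (e f : A ⟶ 𝟙_ C) (g : B ⟶ 𝟙_ C) :
    tensorEffect (e - f) g = tensorEffect e g - tensorEffect f g := by
  rw [eq_sub_iff_add_eq, ← tensorEffect_add_left, sub_add_cancel]

lemma tensorEffect_sum_left {ι : Type*} (P : Finset ι) (e : ι → (A ⟶ 𝟙_ C)) (g : B ⟶ 𝟙_ C) :
    tensorEffect (∑ i ∈ P, e i) g = ∑ i ∈ P, tensorEffect (e i) g := by
  simp only [tensorEffect, sum_tensor, Preadditive.sum_comp]

end Linear

variable {C : Type u} [Category.{v} C] [Preadditive C] [Linear ℝ C] [MonoidalCategory C]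
  [MonoidalPreadditive C] [MonoidalLinear ℝ C] [SymmetricCategory C] (T : GPT C)

section Membership

variable {T} {A B X Y : C}

lemma whiskerLeft_mem (A : C) {f : X ⟶ Y} (hf : f ∈ T.cone X Y) :
    A ◁ f ∈ T.cone (A ⊗ X) (A ⊗ Y) := by
  rw [← id_tensorHom]
  exact T.tensor_mem _ _ (T.id_mem A) hf

lemma whiskerRight_mem {f : X ⟶ Y} (hf : f ∈ T.cone X Y) (A : C) :
    f ▷ A ∈ T.cone (X ⊗ A) (Y ⊗ A) := by
  rw [← tensorHom_id]
  exact T.tensor_mem _ _ hf (T.id_mem A)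

lemma contractRight_mem {χ : X ⟶ A ⊗ B} (hχ : χ ∈ T.cone X (A ⊗ B)) {f : B ⟶ 𝟙_ C}
    (hf : f ∈ T.cone B (𝟙_ C)) : contractRight χ f ∈ T.cone X A :=
  T.comp_mem _ _ hχ (T.comp_mem _ _ (whiskerLeft_mem A hf) (T.rightUnitor_hom_mem A))

lemma contractLeft_mem {χ : X ⟶ A ⊗ B} (hχ : χ ∈ T.cone X (A ⊗ B)) {e : A ⟶ 𝟙_ C}
    (he : e ∈ T.cone A (𝟙_ C)) : contractLeft χ e ∈ T.cone X B :=
  T.comp_mem _ _ hχ (T.comp_mem _ _ (whiskerRight_mem he B) (T.leftUnitor_hom_mem B))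

lemma insertRight_mem {χ : A ⊗ B ⟶ X} (hχ : χ ∈ T.cone (A ⊗ B) X) {t : 𝟙_ C ⟶ B}
    (ht : t ∈ T.cone (𝟙_ C) B) : insertRight χ t ∈ T.cone A X :=
  T.comp_mem _ _ (T.rightUnitor_inv_mem A) (T.comp_mem _ _ (whiskerLeft_mem A ht) hχ)

lemma insertLeft_mem {χ : A ⊗ B ⟶ X} (hχ : χ ∈ T.cone (A ⊗ B) X) {s : 𝟙_ C ⟶ A}
    (hs : s ∈ T.cone (𝟙_ C) A) : insertLeft χ s ∈ T.cone B X :=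
  T.comp_mem _ _ (T.leftUnitor_inv_mem B) (T.comp_mem _ _ (whiskerRight_mem hs B) hχ)

lemma sliceLeft_mem {ψ : A ⊗ B ⟶ X ⊗ Y} (hψ : ψ ∈ T.cone (A ⊗ B) (X ⊗ Y)) {t : 𝟙_ C ⟶ B}
    (ht : t ∈ T.cone (𝟙_ C) B) {f : Y ⟶ 𝟙_ C} (hf : f ∈ T.cone Y (𝟙_ C)) :
    sliceLeft ψ t f ∈ T.cone A X :=
  contractRight_mem (insertRight_mem hψ ht) hf

lemma sliceRight_mem {ψ : A ⊗ B ⟶ X ⊗ Y} (hψ : ψ ∈ T.cone (A ⊗ B) (X ⊗ Y)) {s : 𝟙_ C ⟶ A}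
    (hs : s ∈ T.cone (𝟙_ C) A) {e : X ⟶ 𝟙_ C} (he : e ∈ T.cone X (𝟙_ C)) :
    sliceRight ψ s e ∈ T.cone B Y :=
  contractLeft_mem (insertLeft_mem hψ hs) he

lemma tensorμ_mem (X₁ X₂ Y₁ Y₂ : C) :
    tensorμ X₁ X₂ Y₁ Y₂ ∈ T.cone ((X₁ ⊗ X₂) ⊗ Y₁ ⊗ Y₂) ((X₁ ⊗ Y₁) ⊗ X₂ ⊗ Y₂) :=
  T.comp_mem _ _ (T.associator_hom_mem _ _ _) <|
    T.comp_mem _ _ (whiskerLeft_mem _ (T.associator_inv_mem _ _ _)) <|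
    T.comp_mem _ _ (whiskerLeft_mem _ (whiskerRight_mem (T.braiding_mem _ _) _)) <|
    T.comp_mem _ _ (whiskerLeft_mem _ (T.associator_hom_mem _ _ _)) (T.associator_inv_mem _ _ _)

lemma tensorState_mem {s : 𝟙_ C ⟶ A} {t : 𝟙_ C ⟶ B} (hs : s ∈ T.cone (𝟙_ C) A)
    (ht : t ∈ T.cone (𝟙_ C) B) : tensorState s t ∈ T.cone (𝟙_ C) (A ⊗ B) :=
  T.comp_mem _ _ (T.leftUnitor_inv_mem _) (T.tensor_mem _ _ hs ht)

lemma num_nonneg {s : 𝟙_ C ⟶ A} {e : A ⟶ 𝟙_ C} (hs : s ∈ T.cone (𝟙_ C) A)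
    (he : e ∈ T.cone A (𝟙_ C)) : 0 ≤ T.num (s ≫ e) :=
  (T.mem_cone_unit _).1 (T.comp_mem _ _ hs he)

end Membership

lemma le_iff {A B : C} {f g : A ⟶ B} : T.Le f g ↔ g - f ∈ T.cone A B :=
  ⟨fun ⟨z, hz, h⟩ => by rwa [← h, add_sub_cancel_left], fun h => ⟨_, h, add_sub_cancel f g⟩⟩

lemma exists_mem_mem_eq_sub {A B : C} (f : A ⟶ B) :
    ∃ a ∈ T.cone A B, ∃ b ∈ T.cone A B, f = a - b :=
  exists_mem_mem_eq_sub_of_span_eq_top (T.span_cone A B) f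

lemma effect_eq_zero_of_forall_num_eq_zero {A : C} {e : A ⟶ 𝟙_ C}
    (h : ∀ s ∈ T.cone (𝟙_ C) A, T.num (s ≫ e) = 0) : e = 0 := by
  obtain ⟨a, ha, b, hb, rfl⟩ := T.exists_mem_mem_eq_sub e
  refine sub_eq_zero.2 (T.tomography a b ha hb fun D s f hs hf => ?_)
  have slide (c : A ⟶ 𝟙_ C) : s ≫ c ▷ D ≫ f = contractRight s ((λ_ D).inv ≫ f) ≫ c := by
    rw [contractRight_comp, ← whiskerRight_comp_leftUnitor_comp, Iso.hom_inv_id_assoc]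
  have hab := h _ (contractRight_mem hs (T.comp_mem _ _ (T.leftUnitor_inv_mem D) hf))
  rw [Preadditive.comp_sub, map_sub, sub_eq_zero] at hab
  rw [slide, slide, hab]

section OrderUnit

lemma exists_pos_discard_sub_smul_mem {A : C} {e : A ⟶ 𝟙_ C} (he : e ∈ T.cone A (𝟙_ C)) :
    ∃ r : ℝ, 0 < r ∧ T.discard A - r • e ∈ T.cone A (𝟙_ C) := by
  obtain ⟨r, hr, h⟩ := T.exists_subcausal_smul e he
  rw [T.discard_unit, Category.comp_id] at h
  exact ⟨r, hr, h⟩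

lemma exists_add_smul_discard_mem {A : C} (e : A ⟶ 𝟙_ C) :
    ∃ r : ℝ, e + r • T.discard A ∈ T.cone A (𝟙_ C) := by
  obtain ⟨a, ha, b, hb, rfl⟩ := T.exists_mem_mem_eq_sub e
  obtain ⟨r, hr, h⟩ := T.exists_pos_discard_sub_smul_mem hb
  refine ⟨r⁻¹, ?_⟩
  have hsum := add_mem ha (PointedCone.smul_mem _ (inv_nonneg.2 hr.le) h)
  rw [smul_sub, inv_smul_smul₀ hr.ne'] at hsum
  rwa [sub_add_eq_add_sub, add_sub_assoc]

variable {T}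

/-- By tomography it suffices to test `z` on states `s` and effects `e` of larger systems; there the
order unit `discard` dominates `e`, and it vanishes on the output of `z`. -/
lemma eq_zero_of_neg_comp_discard_mem {A B : C} {z : A ⟶ B} (hz : z ∈ T.cone A B)
    (h : -(z ≫ T.discard B) ∈ T.cone A (𝟙_ C)) : z = 0 := by
  refine T.tomography z 0 hz (zero_mem _) fun D s e hs he => ?_
  have hsz : s ≫ z ▷ D ∈ T.cone (𝟙_ C) (B ⊗ D) := T.comp_mem _ _ hs (whiskerRight_mem hz D)
  have hdiscard : T.num ((s ≫ z ▷ D) ≫ T.discard (B ⊗ D)) ≤ 0 := by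
    have hneg := num_nonneg (contractRight_mem hs (T.discard_mem D)) h
    rw [Preadditive.comp_neg, map_neg, contractRight_comp, Left.nonneg_neg_iff] at hneg
    rwa [Category.assoc, T.discard_tensor', ← whiskerRight_comp_leftUnitor_comp,
      ← comp_whiskerRight_assoc, whiskerRight_comp_leftUnitor_comp]
  obtain ⟨r, hr, hre⟩ := T.exists_pos_discard_sub_smul_mem he
  have hdom := num_nonneg hsz hre
  rw [Preadditive.comp_sub, map_sub, Linear.comp_smul, map_smul, smul_eq_mul, sub_nonneg] at hdom
  have hzero : T.num ((s ≫ z ▷ D) ≫ e) = 0 :=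
    le_antisymm (nonpos_of_mul_nonpos_right (hdom.trans hdiscard) hr) (num_nonneg hsz he)
  simpa using hzero

lemma eq_zero_of_num_discard_eq_zero {A : C} {s : 𝟙_ C ⟶ A} (hs : s ∈ T.cone (𝟙_ C) A)
    (h : T.num (s ≫ T.discard A) = 0) : s = 0 := by
  have hsd : s ≫ T.discard A = 0 := T.num.map_eq_zero_iff.1 h
  exact eq_zero_of_neg_comp_discard_mem hs (by simp [hsd])

lemma IsCausal.num_discard {A : C} {s : 𝟙_ C ⟶ A} (hs : T.IsCausal s) :
    T.num (s ≫ T.discard A) = 1 := by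
  rw [hs.2, T.discard_unit, T.num_id]

lemma isCausal_of_num_discard {A : C} {s : 𝟙_ C ⟶ A} (hs : s ∈ T.cone (𝟙_ C) A)
    (h : T.num (s ≫ T.discard A) = 1) : T.IsCausal s :=
  ⟨hs, T.num.injective (by rw [h, T.discard_unit, T.num_id])⟩

lemma exists_isCausal (T : GPT C) (A : C) : ∃ s : 𝟙_ C ⟶ A, T.IsCausal s :=
  let ⟨s, hs, hsd⟩ := T.exists_causal_state A
  ⟨s, hs, hsd.trans T.discard_unit.symm⟩

lemma exists_eq_smul_isCausal {A : C} {s : 𝟙_ C ⟶ A} (hs : s ∈ T.cone (𝟙_ C) A) :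
    ∃ t, T.IsCausal t ∧ s = T.num (s ≫ T.discard A) • t := by
  obtain hd | hd := (num_nonneg hs (T.discard_mem A)).eq_or_lt
  · obtain ⟨t, ht⟩ := T.exists_isCausal A
    exact ⟨t, ht, by rw [← hd, zero_smul, eq_zero_of_num_discard_eq_zero hs hd.symm]⟩
  · refine ⟨(T.num (s ≫ T.discard A))⁻¹ • s, isCausal_of_num_discard
      (PointedCone.smul_mem _ (inv_nonneg.2 hd.le) hs) ?_, (smul_inv_smul₀ hd.ne' s).symm⟩
    rw [Linear.smul_comp, map_smul, smul_eq_mul, inv_mul_cancel₀ hd.ne']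

end OrderUnit

section Subcausal

variable {T} {A B : C}

lemma num_comp_le {s : 𝟙_ C ⟶ A} (hs : s ∈ T.cone (𝟙_ C) A) {e f : A ⟶ 𝟙_ C} (h : T.Le e f) :
    T.num (s ≫ e) ≤ T.num (s ≫ f) := by
  simpa only [Preadditive.comp_sub, map_sub, sub_nonneg] using num_nonneg hs (T.le_iff.1 h)

lemma isSubcausal_iff {f : A ⟶ B} :
    T.IsSubcausal f ↔ f ∈ T.cone A B ∧ T.discard A - f ≫ T.discard B ∈ T.cone A (𝟙_ C) :=
  and_congr_right fun _ => T.le_iff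

lemma zero_isSubcausal (A B : C) : T.IsSubcausal (0 : A ⟶ B) :=
  isSubcausal_iff.2 ⟨zero_mem _, by simpa using T.discard_mem A⟩

lemma IsCausal.isSubcausal {f : A ⟶ B} (hf : T.IsCausal f) : T.IsSubcausal f :=
  isSubcausal_iff.2 ⟨hf.1, by rw [hf.2, sub_self]; exact zero_mem _⟩

lemma IsSubcausal.num_comp_comp_le {s : 𝟙_ C ⟶ A} (hs : s ∈ T.cone (𝟙_ C) A) {χ : A ⟶ B}
    (hχ : T.IsSubcausal χ) {e : B ⟶ 𝟙_ C} (he : T.Le e (T.discard B)) :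
    T.num (s ≫ χ ≫ e) ≤ T.num (s ≫ T.discard A) := by
  refine le_trans ?_ (num_comp_le hs hχ.2)
  simpa only [Category.assoc] using num_comp_le (T.comp_mem _ _ hs hχ.1) he

end Subcausal

/-- The canonical topology of a finite-dimensional space, in which `isClosed_cone` is stated. -/
local instance homTopology (A B : C) : TopologicalSpace (A ⟶ B) := moduleTopology ℝ _

local instance homIsModuleTopology (A B : C) : IsModuleTopology ℝ (A ⟶ B) := ⟨rfl⟩

local instance homIsTopologicalAddGroup (A B : C) : IsTopologicalAddGroup (A ⟶ B) :=
  IsModuleTopology.topologicalAddGroup ℝ _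

variable {T}

lemma t2Space_hom (T : GPT C) (A B : C) : T2Space (A ⟶ B) :=
  haveI := T.finite A B
  t2Space_of_isModuleTopology

lemma isCompact_setOf_isSubcausal (A B : C) : IsCompact {f : A ⟶ B | T.IsSubcausal f} := by
  have := T.finite A B
  have := T.t2Space_hom A B
  let δ : (A ⟶ B) →ᵃ[ℝ] (A ⟶ 𝟙_ C) :=
    AffineMap.const ℝ _ (T.discard A) - (Linear.rightComp ℝ A (T.discard B)).toAffineMap
  have hδ : Continuous δ := continuous_const.sub
    (IsModuleTopology.continuous_of_linearMap (Linear.rightComp ℝ A (T.discard B)))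
  have hS : {f : A ⟶ B | T.IsSubcausal f} = (T.cone A B : Set (A ⟶ B)) ∩ δ ⁻¹' T.cone A (𝟙_ C) :=
    Set.ext fun _ => isSubcausal_iff
  refine isCompact_of_forall_ray_trivial ?_ ?_ ?_
  · rw [hS]
    exact (T.isClosed_cone A B).inter ((T.isClosed_cone A (𝟙_ C)).preimage hδ)
  · rw [hS]
    exact (T.cone A B).convex.inter ((T.cone A (𝟙_ C)).convex.affine_preimage δ)
  · intro f _ z hz
    refine eq_zero_of_neg_comp_discard_mem
      (mem_of_forall_add_smul_mem (T.isClosed_cone A B) fun r hr => (hz r hr).1)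
      (mem_of_forall_add_smul_mem (T.isClosed_cone A (𝟙_ C))
        (x := T.discard A - f ≫ T.discard B) fun r hr => ?_)
    convert (isSubcausal_iff.1 (hz r hr)).2 using 1
    rw [Preadditive.add_comp, Linear.smul_comp, smul_neg]
    abel

lemma isCompact_causalStates (A : C) : IsCompact (T.causalStates A) := by
  have := T.t2Space_hom (𝟙_ C) (𝟙_ C)
  have hS : T.causalStates A = {s | T.IsSubcausal s} ∩
      (fun s : 𝟙_ C ⟶ A => s ≫ T.discard A) ⁻¹' {T.discard (𝟙_ C)} :=
    Set.ext fun s => ⟨fun hs => ⟨hs.isSubcausal, hs.2⟩, fun hs => ⟨hs.1.1, hs.2⟩⟩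
  rw [hS]
  exact (isCompact_setOf_isSubcausal _ _).inter_right <| isClosed_singleton.preimage
    (IsModuleTopology.continuous_of_linearMap (Linear.rightComp ℝ (𝟙_ C) (T.discard A)))

lemma exists_nonneg_on_cone_neg {A B : C} {f : A ⟶ B} (hf : f ∉ T.cone A B) :
    ∃ φ : (A ⟶ B) →ₗ[ℝ] ℝ, (∀ g ∈ T.cone A B, 0 ≤ φ g) ∧ φ f < 0 := by
  have := T.finite A B
  have := T.t2Space_hom A B
  have : LocallyConvexSpace ℝ (A ⟶ B) := locallyConvexSpace_of_finiteDimensional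
  obtain ⟨φ, hφ, hφf⟩ := ProperCone.hyperplane_separation_point
    ⟨T.cone A B, T.isClosed_cone A B⟩ hf
  exact ⟨φ.toLinearMap, hφ, hφf⟩

/-- The evaluation of effects on states. -/
noncomputable def pairing (T : GPT C) (A : C) : (𝟙_ C ⟶ A) →ₗ[ℝ] (A ⟶ 𝟙_ C) →ₗ[ℝ] ℝ :=
  LinearMap.mk₂ ℝ (fun s e => T.num (s ≫ e)) (by simp) (by simp) (by simp) (by simp)

@[simp]
lemma pairing_apply (A : C) (s : 𝟙_ C ⟶ A) (e : A ⟶ 𝟙_ C) :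
    T.pairing A s e = T.num (s ≫ e) :=
  rfl

lemma pairing_surjective (T : GPT C) (A : C) : Function.Surjective (T.pairing A) := by
  have := T.finite A (𝟙_ C)
  have := T.finite (𝟙_ C) A
  rw [← LinearMap.flip_injective_iff₁, ← LinearMap.ker_eq_bot, LinearMap.ker_eq_bot']
  exact fun e he => T.effect_eq_zero_of_forall_num_eq_zero fun s _ => LinearMap.congr_fun he s

lemma NoRestriction.exists_state (hNR : T.NoRestriction) {A : C}
    (σ : (A ⟶ 𝟙_ C) →ₗ[ℝ] ℝ) (hσ : ∀ e ∈ T.cone A (𝟙_ C), 0 ≤ σ e) :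
    ∃ s ∈ T.cone (𝟙_ C) A, ∀ e, T.num (s ≫ e) = σ e := by
  obtain ⟨s, rfl⟩ := T.pairing_surjective A σ
  refine ⟨s, ?_, fun _ => rfl⟩
  by_contra hs
  obtain ⟨φ, hφ, hφs⟩ := exists_nonneg_on_cone_neg hs
  obtain ⟨e, he, heφ⟩ := hNR A φ hφ
  exact hφs.not_ge (heφ s ▸ hσ e he)

variable {A B : C}

namespace BankStrategy

variable (S : T.BankStrategy A) (S' : T.BankStrategy B)

/-- The success probability as a linear functional of the counterfeiting machine. -/
noncomputable def successLinear : (A ⟶ A ⊗ A) →ₗ[ℝ] ℝ where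
  toFun := S.successProb
  map_add' χ χ' := by
    simp only [successProb, Preadditive.add_comp, Preadditive.comp_add, map_add, mul_add,
      Finset.sum_add_distrib]
  map_smul' r χ := by
    simp only [successProb, Linear.smul_comp, Linear.comp_smul, map_smul, smul_eq_mul,
      RingHom.id_apply, Finset.mul_sum, mul_left_comm]

@[simp]
lemma successLinear_apply (χ : A ⟶ A ⊗ A) : S.successLinear χ = S.successProb χ := rfl

lemma num_verify_le_one {χ : A ⟶ A ⊗ A} (hχ : T.IsSubcausal χ) (i : S.ι) :
    T.num (S.s i ≫ χ ≫ tensorEffect (S.e i) (S.e i)) ≤ 1 := by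
  rw [← (S.s_causal i).num_discard]
  exact hχ.num_comp_comp_le (S.s_causal i).1 (T.tensorEffect_le (S.e_mem i) (S.e_le i) (S.e_le i))

lemma successProb_le_one {χ : A ⟶ A ⊗ A} (hχ : T.IsSubcausal χ) : S.successProb χ ≤ 1 := by
  rw [← S.p_sum]
  exact Finset.sum_le_sum fun i _ =>
    mul_le_of_le_one_right (S.p_pos i).le (S.num_verify_le_one hχ i)

lemma successProb_le_alpha {χ : A ⟶ A ⊗ A} (hχ : T.IsSubcausal χ) :
    S.successProb χ ≤ S.alpha :=
  le_csSup ⟨1, Set.forall_mem_image.2 fun _ hχ' => S.successProb_le_one hχ'⟩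
    (Set.mem_image_of_mem _ hχ)

lemma alpha_nonneg : 0 ≤ S.alpha := by
  simpa only [← successLinear_apply, map_zero] using
    S.successProb_le_alpha (zero_isSubcausal A (A ⊗ A))

lemma alpha_le {a : ℝ} (h : ∀ χ : A ⟶ A ⊗ A, T.IsSubcausal χ → S.successProb χ ≤ a) :
    S.alpha ≤ a :=
  csSup_le ⟨_, 0, zero_isSubcausal A (A ⊗ A), rfl⟩ (Set.forall_mem_image.2 h)

lemma exists_successProb_eq_alpha :
    ∃ χ : A ⟶ A ⊗ A, T.IsSubcausal χ ∧ S.successProb χ = S.alpha := by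
  obtain ⟨χ, hχ, hmax⟩ := (isCompact_setOf_isSubcausal A (A ⊗ A)).exists_isMaxOn
    ⟨0, zero_isSubcausal A (A ⊗ A)⟩
    (IsModuleTopology.continuous_of_linearMap S.successLinear).continuousOn
  exact ⟨χ, hχ, le_antisymm (S.successProb_le_alpha hχ) (S.alpha_le hmax)⟩

lemma successProb_le_mul_alpha {χ : A ⟶ A ⊗ A} (hχ : χ ∈ T.cone A (A ⊗ A)) {r : ℝ}
    (hr : r • T.discard A - χ ≫ T.discard (A ⊗ A) ∈ T.cone A (𝟙_ C)) :
    S.successProb χ ≤ r * S.alpha := by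
  have hr0 : 0 ≤ r := by
    obtain ⟨s, hs⟩ := T.exists_isCausal A
    have hle := num_nonneg hs.1 hr
    rw [Preadditive.comp_sub, Linear.comp_smul, map_sub, map_smul, hs.num_discard, smul_eq_mul,
      mul_one, sub_nonneg] at hle
    exact (num_nonneg hs.1 (T.comp_mem _ _ hχ (T.discard_mem _))).trans hle
  obtain rfl | hr0 := hr0.eq_or_lt
  · have hχ0 : χ = 0 := eq_zero_of_neg_comp_discard_mem hχ (by simpa using hr)
    rw [hχ0, ← successLinear_apply, map_zero, zero_mul]
  · have hsub : T.IsSubcausal (r⁻¹ • χ) := by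
      refine isSubcausal_iff.2 ⟨PointedCone.smul_mem _ (inv_nonneg.2 hr0.le) hχ, ?_⟩
      have hscaled := PointedCone.smul_mem _ (inv_nonneg.2 hr0.le) hr
      rwa [smul_sub, inv_smul_smul₀ hr0.ne', ← Linear.smul_comp] at hscaled
    have hle := S.successProb_le_alpha hsub
    rwa [← successLinear_apply, map_smul, smul_eq_mul, inv_mul_le_iff₀ hr0] at hle

/-- A feasible point of the conic program dual to the one that defines `alpha`: a state `σ` such
that discarding both outputs of a counterfeiting machine run on `σ` succeeds at least as well as the
counterfeiting itself. By duality the least value of `num (σ ≫ T.discard A)` is `alpha`. -/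
def IsCertificate (σ : 𝟙_ C ⟶ A) : Prop :=
  σ ∈ T.cone (𝟙_ C) A ∧ ∀ χ ∈ T.cone A (A ⊗ A),
    S.successProb χ ≤ T.num (σ ≫ χ ≫ T.discard (A ⊗ A))

variable {S S'} in
lemma IsCertificate.alpha_le {σ : 𝟙_ C ⟶ A} (hσ : S.IsCertificate σ) :
    S.alpha ≤ T.num (σ ≫ T.discard A) :=
  S.alpha_le fun χ hχ => (hσ.2 χ hχ.1).trans (num_comp_le hσ.1 hχ.2)

lemma exists_isCertificate (hNR : T.NoRestriction) :
    ∃ σ, S.IsCertificate σ ∧ T.num (σ ≫ T.discard A) = S.alpha := by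
  obtain ⟨φ, hφ, hφd, hφS⟩ := exists_conic_dual (Φ := S.successLinear)
    (δ := Linear.rightComp ℝ A (T.discard (A ⊗ A))) T.exists_add_smul_discard_mem
    fun χ hχ r hr => S.successProb_le_mul_alpha hχ hr
  obtain ⟨σ, hσ, hσφ⟩ := hNR.exists_state φ hφ
  exact ⟨σ, ⟨hσ, fun χ hχ => (hφS χ hχ).trans_eq (hσφ _).symm⟩, (hσφ _).trans hφd⟩

lemma successProb_prod (χ : A ⊗ B ⟶ (A ⊗ B) ⊗ A ⊗ B) :
    (S.prod S').successProb χ = ∑ j, S'.p j * S.successProb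
      (sliceLeft (χ ≫ tensorμ A B A B) (S'.s j) (tensorEffect (S'.e j) (S'.e j))) := by
  change ∑ i : S.ι × S'.ι, S.p i.1 * S'.p i.2 * T.num (tensorState (S.s i.1) (S'.s i.2) ≫ χ ≫
    tensorEffect (tensorEffect (S.e i.1) (S'.e i.2)) (tensorEffect (S.e i.1) (S'.e i.2))) = _
  rw [Fintype.sum_prod_type_right]
  simp only [successProb, Finset.mul_sum, comp_sliceLeft_comp, Category.assoc,
    tensorμ_comp_tensorEffect]
  exact Finset.sum_congr rfl fun j _ => Finset.sum_congr rfl fun i _ => by ring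

variable {S S'} in
lemma IsCertificate.prod {σ : 𝟙_ C ⟶ A} {τ : 𝟙_ C ⟶ B} (hσ : S.IsCertificate σ)
    (hτ : S'.IsCertificate τ) : (S.prod S').IsCertificate (tensorState σ τ) := by
  refine ⟨tensorState_mem hσ.1 hτ.1, fun χ hχ => ?_⟩
  have hψ : χ ≫ tensorμ A B A B ∈ T.cone (A ⊗ B) ((A ⊗ A) ⊗ B ⊗ B) :=
    T.comp_mem _ _ hχ (tensorμ_mem A B A B)
  let χA (j : S'.ι) : A ⟶ A ⊗ A :=
    sliceLeft (χ ≫ tensorμ A B A B) (S'.s j) (tensorEffect (S'.e j) (S'.e j))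
  have hχA (j : S'.ι) : χA j ∈ T.cone A (A ⊗ A) :=
    sliceLeft_mem hψ (S'.s_causal j).1 (T.tensorEffect_mem (S'.e_mem j) (S'.e_mem j))
  let χB : B ⟶ B ⊗ B := sliceRight (χ ≫ tensorμ A B A B) σ (T.discard (A ⊗ A))
  have hχB : χB ∈ T.cone B (B ⊗ B) := sliceRight_mem hψ hσ.1 (T.discard_mem (A ⊗ A))
  calc (S.prod S').successProb χ
      = ∑ j, S'.p j * S.successProb (χA j) := S.successProb_prod S' χ
    _ ≤ ∑ j, S'.p j * T.num (σ ≫ χA j ≫ T.discard (A ⊗ A)) :=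
        Finset.sum_le_sum fun j _ =>
          mul_le_mul_of_nonneg_left (hσ.2 _ (hχA j)) (S'.p_pos j).le
    _ = S'.successProb χB := by
        simp only [successProb, χA, χB, comp_sliceLeft_comp, comp_sliceRight_comp]
    _ ≤ T.num (τ ≫ χB ≫ T.discard (B ⊗ B)) := hτ.2 _ hχB
    _ = T.num (tensorState σ τ ≫ χ ≫ T.discard ((A ⊗ B) ⊗ A ⊗ B)) := by
        simp only [χB, comp_sliceRight_comp, Category.assoc, T.discard_tensor',
          tensorμ_comp_tensorEffect]

lemma alpha_prod_le (hNR : T.NoRestriction) : (S.prod S').alpha ≤ S.alpha * S'.alpha := by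
  obtain ⟨σ, hσ, hσα⟩ := S.exists_isCertificate hNR
  obtain ⟨τ, hτ, hτα⟩ := S'.exists_isCertificate hNR
  refine (hσ.prod hτ).alpha_le.trans_eq ?_
  rw [T.discard_tensor', tensorState_comp_tensorEffect, T.num_comp, hσα, hτα, mul_comm]

lemma alpha_copies_le (hNR : T.NoRestriction) (n : ℕ) :
    (S.copies n).alpha ≤ S.alpha ^ (n + 1) := by
  induction n with
  | zero => simp only [zero_add, pow_one, copies, tensorPow, le_refl]
  | succ n ih =>
    rw [pow_succ]
    exact (alpha_prod_le _ _ hNR).trans (mul_le_mul_of_nonneg_right ih S.alpha_nonneg)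

lemma snc_of_alpha_lt_one (hNR : T.NoRestriction) (h : S.alpha < 1) : T.SNC := by
  intro δ hδ
  obtain ⟨n, hn⟩ := exists_pow_lt_of_lt_one hδ h
  refine ⟨_, S.copies n, (S.alpha_copies_le hNR n).trans ?_⟩
  exact (pow_le_pow_of_le_one S.alpha_nonneg h.le n.le_succ).trans hn.le

end BankStrategy

section Subcausal

variable {D : C}

lemma IsSubcausal.comp {f : A ⟶ B} {g : B ⟶ D} (hf : T.IsSubcausal f) (hg : T.IsSubcausal g) :
    T.IsSubcausal (f ≫ g) := by
  rw [isSubcausal_iff] at hf hg ⊢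
  refine ⟨T.comp_mem _ _ hf.1 hg.1, ?_⟩
  have hsum := add_mem hf.2 (T.comp_mem _ _ hf.1 hg.2)
  rwa [Preadditive.comp_sub, sub_add_sub_cancel, ← Category.assoc] at hsum

lemma isSubcausal_effect_iff {e : A ⟶ 𝟙_ C} :
    T.IsSubcausal e ↔ e ∈ T.cone A (𝟙_ C) ∧ T.Le e (T.discard A) := by
  rw [IsSubcausal, T.discard_unit, Category.comp_id]

lemma discard_isSubcausal (A : C) : T.IsSubcausal (T.discard A) :=
  isSubcausal_effect_iff.2 ⟨T.discard_mem A, T.le_iff.2 (by simp)⟩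

lemma IsSubcausal.discard_sub {e : A ⟶ 𝟙_ C} (he : T.IsSubcausal e) :
    T.IsSubcausal (T.discard A - e) := by
  rw [isSubcausal_effect_iff, le_iff] at he ⊢
  exact ⟨he.2, by simpa using he.1⟩

lemma IsSubcausal.tensorEffect {e : A ⟶ 𝟙_ C} (he : T.IsSubcausal e) {f : B ⟶ 𝟙_ C}
    (hf : T.IsSubcausal f) : T.IsSubcausal (tensorEffect e f) := by
  rw [isSubcausal_effect_iff] at he hf ⊢
  exact ⟨T.tensorEffect_mem he.1 hf.1, T.tensorEffect_le he.1 he.2 hf.2⟩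

lemma IsSubcausal.num_comp_le_one {s : 𝟙_ C ⟶ A} (hs : T.IsSubcausal s) {e : A ⟶ 𝟙_ C}
    (he : T.IsSubcausal e) : T.num (s ≫ e) ≤ 1 := by
  rw [← T.num_id, ← T.discard_unit, ← sub_nonneg, ← map_sub, ← mem_cone_unit, ← le_iff]
  exact (isSubcausal_effect_iff.1 (hs.comp he)).2

lemma num_comp_eq_of_forall_isSubcausal {s t : 𝟙_ C ⟶ A}
    (h : ∀ e, T.IsSubcausal e → T.num (s ≫ e) = T.num (t ≫ e)) (e : A ⟶ 𝟙_ C) :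
    T.num (s ≫ e) = T.num (t ≫ e) := by
  have hcone {e : A ⟶ 𝟙_ C} (he : e ∈ T.cone A (𝟙_ C)) : T.num (s ≫ e) = T.num (t ≫ e) := by
    obtain ⟨r, hr, hre⟩ := T.exists_pos_discard_sub_smul_mem he
    have hsmul := h (r • e) (isSubcausal_effect_iff.2
      ⟨PointedCone.smul_mem _ hr.le he, T.le_iff.2 hre⟩)
    simpa only [Linear.comp_smul, map_smul, smul_eq_mul, mul_right_inj' hr.ne'] using hsmul
  obtain ⟨a, ha, b, hb, rfl⟩ := T.exists_mem_mem_eq_sub e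
  rw [Preadditive.comp_sub, Preadditive.comp_sub, map_sub, map_sub, hcone ha, hcone hb]

end Subcausal

/-- The effect `e` is sharp at the state `s`: among the subcausal states, it accepts with certainty
exactly `s`. A bank strategy satisfies Verification Sharpness if each `e i` is sharp at `s i`. -/
def IsSharp (T : GPT C) (e : A ⟶ 𝟙_ C) (s : 𝟙_ C ⟶ A) : Prop :=
  ∀ t : 𝟙_ C ⟶ A, T.IsSubcausal t → (T.num (t ≫ e) = 1 ↔ t = s)

lemma IsSharp.eq_smul {e : A ⟶ 𝟙_ C} {s t : 𝟙_ C ⟶ A} (he : T.IsSharp e s)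
    (ht : t ∈ T.cone (𝟙_ C) A) (h : T.num (t ≫ e) = T.num (t ≫ T.discard A)) :
    t = T.num (t ≫ T.discard A) • s := by
  obtain ⟨t', ht', hsmul⟩ := exists_eq_smul_isCausal ht
  by_cases hd : T.num (t ≫ T.discard A) = 0
  · rw [hd, eq_zero_of_num_discard_eq_zero ht hd, zero_smul]
  · have haccept : T.num (t' ≫ e) = 1 := by
      rw [hsmul, Linear.smul_comp, map_smul, ← hsmul, smul_eq_mul] at h
      exact mul_left_cancel₀ hd (h.trans (mul_one _).symm)
    rwa [(he t' ht'.isSubcausal).1 haccept] at hsmul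

section Bipartite

variable {ω : 𝟙_ C ⟶ A ⊗ B} {e : A ⟶ 𝟙_ C} {e' : B ⟶ 𝟙_ C} {s : 𝟙_ C ⟶ A} {s' : 𝟙_ C ⟶ B}

lemma contractLeft_eq_of_isSharp (hω : T.IsSubcausal ω) (he : T.IsSubcausal e)
    (he' : T.IsSharp e' s') (h : T.num (ω ≫ tensorEffect e e') = 1) : contractLeft ω e = s' := by
  refine (he' _ ?_).1 (by rw [contractLeft_comp, h])
  have hmem := contractLeft_mem hω.1 (isSubcausal_effect_iff.1 he).1
  refine ⟨hmem, T.le_iff.2 ?_⟩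
  rw [mem_cone_unit, map_sub, T.discard_unit, T.num_id, contractLeft_comp, sub_nonneg]
  exact hω.num_comp_le_one (he.tensorEffect (discard_isSubcausal B))

/-- The bounds from `e ≤ discard` for `f` and for `discard - f` add up to an equality. -/
lemma num_comp_tensorEffect_discard_of_isSharp (hω : T.IsSubcausal ω) (he : T.IsSubcausal e)
    (he' : T.IsSharp e' s') (hs' : T.IsCausal s') (h : T.num (ω ≫ tensorEffect e e') = 1)
    {f : B ⟶ 𝟙_ C} (hf : T.IsSubcausal f) :
    T.num (ω ≫ tensorEffect (T.discard A) f) = T.num (s' ≫ f) := by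
  have hle {k : B ⟶ 𝟙_ C} (hk : T.IsSubcausal k) :
      T.num (s' ≫ k) ≤ T.num (ω ≫ tensorEffect (T.discard A) k) := by
    rw [← contractLeft_eq_of_isSharp hω he he' h, contractLeft_comp, ← contractRight_comp,
      ← contractRight_comp]
    exact num_comp_le (contractRight_mem hω.1 hk.1) (isSubcausal_effect_iff.1 he).2
  have hcompl := hle hf.discard_sub
  rw [tensorEffect_sub_right, Preadditive.comp_sub, Preadditive.comp_sub, map_sub, map_sub,
    hs'.num_discard] at hcompl
  have htotal := hω.num_comp_le_one ((discard_isSubcausal A).tensorEffect (discard_isSubcausal B))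
  exact le_antisymm (by linarith) (hle hf)

lemma num_comp_tensorEffect_of_isSharp (hω : T.IsSubcausal ω) (he : T.IsSubcausal e)
    (hes : T.IsSharp e s) (he' : T.IsSharp e' s') (hs' : T.IsCausal s')
    (h : T.num (ω ≫ tensorEffect e e') = 1) (k : A ⟶ 𝟙_ C) (f : B ⟶ 𝟙_ C) :
    T.num (ω ≫ tensorEffect k f) = T.num (s ≫ k) * T.num (s' ≫ f) := by
  have hsub {f : B ⟶ 𝟙_ C} (hf : T.IsSubcausal f) :
      T.num (contractLeft ω k ≫ f) = T.num ((T.num (s ≫ k) • s') ≫ f) := by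
    have hd : T.num (contractRight ω f ≫ T.discard A) = T.num (s' ≫ f) := by
      rw [contractRight_comp, num_comp_tensorEffect_discard_of_isSharp hω he he' hs' h hf]
    have hmarginal : contractRight ω f = T.num (s' ≫ f) • s := by
      rw [← hd]
      refine hes.eq_smul (contractRight_mem hω.1 hf.1) ?_
      rw [hd, contractRight_comp, ← contractLeft_comp, contractLeft_eq_of_isSharp hω he he' h]
    rw [contractLeft_comp, ← contractRight_comp, hmarginal]
    simp only [Linear.smul_comp, map_smul, smul_eq_mul, mul_comm]
  have hall := num_comp_eq_of_forall_isSubcausal (fun _ => hsub) f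
  rwa [contractLeft_comp, Linear.smul_comp, map_smul, smul_eq_mul] at hall

end Bipartite

/-- The process `χ` clones the state `s`: to product effects, its output on `s` looks like two
independent copies of `s`. -/
def Clones (T : GPT C) (χ : A ⟶ A ⊗ A) (s : 𝟙_ C ⟶ A) : Prop :=
  ∀ e f : A ⟶ 𝟙_ C, T.num (s ≫ χ ≫ tensorEffect e f) = T.num (s ≫ e) * T.num (s ≫ f)

lemma IsSharp.clones {χ : A ⟶ A ⊗ A} (hχ : T.IsSubcausal χ) {s : 𝟙_ C ⟶ A} (hs : T.IsCausal s)
    {e : A ⟶ 𝟙_ C} (he : T.IsSubcausal e) (hes : T.IsSharp e s)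
    (h : T.num (s ≫ χ ≫ tensorEffect e e) = 1) : T.Clones χ s := by
  intro k f
  rw [← Category.assoc] at h ⊢
  exact num_comp_tensorEffect_of_isSharp (hs.isSubcausal.comp hχ) he hes hes hs h k f

section Measurement

variable {ι : Type*} {χ : A ⟶ A ⊗ A} {t : ι → (𝟙_ C ⟶ A)}

/-- An effect `g` accepting `t i` with certainty and minimising the total weight of the other states
is separating: cloning and then applying `g` and `e` multiplies the weight of `t j` by
`num (t j ≫ e) < 1`. -/
lemma exists_separating_effect [Finite ι] (hχ : T.IsSubcausal χ) (ht : ∀ i, T.IsCausal (t i))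
    (hclone : ∀ i, T.Clones χ (t i)) (i : ι) {e : A ⟶ 𝟙_ C} (he : T.IsSubcausal e)
    (hei : T.num (t i ≫ e) = 1) (hej : ∀ j, j ≠ i → T.num (t j ≫ e) ≠ 1) :
    ∃ g : A ⟶ 𝟙_ C, T.IsSubcausal g ∧ T.num (t i ≫ g) = 1 ∧
      ∀ j, j ≠ i → T.num (t j ≫ g) = 0 := by
  classical
  have := Fintype.ofFinite ι
  let weight : (A ⟶ 𝟙_ C) →ₗ[ℝ] ℝ := ∑ j ∈ Finset.univ.erase i, T.pairing A (t j)
  have hweight (h : A ⟶ 𝟙_ C) : weight h = ∑ j ∈ Finset.univ.erase i, T.num (t j ≫ h) := by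
    simp only [weight, LinearMap.sum_apply, pairing_apply]
  have hcompact : IsCompact ({g : A ⟶ 𝟙_ C | T.IsSubcausal g} ∩ T.pairing A (t i) ⁻¹' {1}) :=
    (isCompact_setOf_isSubcausal A (𝟙_ C)).inter_right <| isClosed_singleton.preimage
      (IsModuleTopology.continuous_of_linearMap (T.pairing A (t i)))
  obtain ⟨g, ⟨hg, hgi⟩, hmin⟩ := hcompact.exists_isMinOn ⟨e, he, hei⟩
    (IsModuleTopology.continuous_of_linearMap weight).continuousOn
  refine ⟨g, hg, hgi, fun j hj => ?_⟩
  have hlt (j : ι) (hj : j ≠ i) : T.num (t j ≫ e) < 1 :=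
    ((ht j).isSubcausal.num_comp_le_one he).lt_of_ne (hej j hj)
  have hsharper : χ ≫ tensorEffect g e ∈
      {g : A ⟶ 𝟙_ C | T.IsSubcausal g} ∩ T.pairing A (t i) ⁻¹' {1} :=
    ⟨hχ.comp (hg.tensorEffect he), by
      rw [Set.mem_preimage, pairing_apply, hclone i, hei, mul_one]
      exact hgi⟩
  have hloss : ∑ j ∈ Finset.univ.erase i, T.num (t j ≫ g) * (1 - T.num (t j ≫ e)) ≤ 0 := by
    have hle := isMinOn_iff.1 hmin _ hsharper
    rw [hweight, hweight, ← sub_nonpos, ← Finset.sum_sub_distrib] at hle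
    simpa only [hclone _ _ _, mul_sub, mul_one] using hle
  have hnonneg : ∀ j ∈ Finset.univ.erase i, 0 ≤ T.num (t j ≫ g) * (1 - T.num (t j ≫ e)) :=
    fun j hj => mul_nonneg (num_nonneg (ht j).1 hg.1)
      (sub_nonneg.2 (hlt j (Finset.ne_of_mem_erase hj)).le)
  have hzero := (Finset.sum_eq_zero_iff_of_nonneg hnonneg).1
    (hloss.antisymm (Finset.sum_nonneg hnonneg)) j (Finset.mem_erase.2 ⟨hj, Finset.mem_univ j⟩)
  exact (mul_eq_zero.1 hzero).resolve_right (sub_pos.2 (hlt j hj)).ne'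

/-- Clone, test the second copy with `g`, and apply `H` to the first copy if the test fails. -/
lemma sequential_test_le (hχ : T.IsSubcausal χ) {g H : A ⟶ 𝟙_ C} (hg : T.IsSubcausal g)
    (hH : T.Le H (T.discard A)) :
    T.Le (χ ≫ tensorEffect (T.discard A) g + χ ≫ tensorEffect H (T.discard A - g))
      (T.discard A) := by
  rw [le_iff] at hH ⊢
  have hsum := add_mem (isSubcausal_iff.1 hχ).2
    (T.comp_mem _ _ hχ.1 (T.tensorEffect_mem hH hg.discard_sub.1))
  convert hsum using 1
  rw [T.discard_tensor', tensorEffect_sub_left, tensorEffect_sub_right (T.discard A),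
    Preadditive.comp_sub, Preadditive.comp_sub]
  abel

variable [DecidableEq ι]

lemma exists_partial_measurement (hχ : T.IsSubcausal χ) (ht : ∀ i, T.IsCausal (t i))
    (hclone : ∀ i, T.Clones χ (t i)) {g : ι → (A ⟶ 𝟙_ C)} (hg : ∀ k, T.IsSubcausal (g k))
    (hgt : ∀ j k, T.num (t j ≫ g k) = if j = k then 1 else 0) (P : Finset ι) :
    ∃ F : ι → (A ⟶ 𝟙_ C), (∀ k, F k ∈ T.cone A (𝟙_ C)) ∧ T.Le (∑ k ∈ P, F k) (T.discard A) ∧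
      ∀ k ∈ P, ∀ j, T.num (t j ≫ F k) = if j = k then 1 else 0 := by
  induction P using Finset.induction_on with
  | empty => exact ⟨0, fun _ => zero_mem _, T.le_iff.2 (by simpa using T.discard_mem A), by simp⟩
  | insert m P hm ih =>
    obtain ⟨F, hFmem, hFsum, hF⟩ := ih
    have hne (k : ι) (hk : k ∈ P) : k ≠ m := fun h => hm (h ▸ hk)
    refine ⟨fun k => if k = m then χ ≫ tensorEffect (T.discard A) (g m) else
      χ ≫ tensorEffect (F k) (T.discard A - g m), fun k => ?_, ?_, fun k hk j => ?_⟩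
    · dsimp only
      split_ifs
      · exact T.comp_mem _ _ hχ.1 (T.tensorEffect_mem (T.discard_mem A) (hg m).1)
      · exact T.comp_mem _ _ hχ.1 (T.tensorEffect_mem (hFmem k) (hg m).discard_sub.1)
    · rw [Finset.sum_insert hm, if_pos rfl, Finset.sum_congr rfl fun k hk => if_neg (hne k hk),
        ← Preadditive.comp_sum, ← tensorEffect_sum_left]
      exact sequential_test_le hχ (hg m) hFsum
    · dsimp only
      obtain rfl | hkP := Finset.mem_insert.1 hk
      · rw [if_pos rfl, hclone, (ht j).num_discard, one_mul, hgt]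
      · rw [if_neg (hne k hkP), hclone, hF k hkP, Preadditive.comp_sub, map_sub,
          (ht j).num_discard, hgt]
        obtain rfl | hjk := eq_or_ne j k
        · simp only [hne j hkP, if_true, if_false, sub_zero, mul_one]
        · simp only [hjk, if_false, zero_mul]

lemma exists_measurement [Fintype ι] [Nonempty ι] (hχ : T.IsSubcausal χ)
    (ht : ∀ i, T.IsCausal (t i)) (hclone : ∀ i, T.Clones χ (t i)) {g : ι → (A ⟶ 𝟙_ C)}
    (hg : ∀ k, T.IsSubcausal (g k))
    (hgt : ∀ j k, T.num (t j ≫ g k) = if j = k then 1 else 0) :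
    ∃ f : ι → (A ⟶ 𝟙_ C), (∀ k, f k ∈ T.cone A (𝟙_ C)) ∧ ∑ k, f k = T.discard A ∧
      ∀ j k, T.num (t j ≫ f k) = if j = k then 1 else 0 := by
  obtain ⟨F, hFmem, ⟨rest, hrest, hsum⟩, hF⟩ :=
    exists_partial_measurement hχ ht hclone hg hgt Finset.univ
  let o : ι := Classical.arbitrary ι
  have hrest0 (j : ι) : T.num (t j ≫ rest) = 0 := by
    rw [← add_sub_cancel_left (∑ k, F k) rest, hsum, Preadditive.comp_sub, map_sub,
      (ht j).num_discard, Preadditive.comp_sum, map_sum]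
    simp [hF]
  refine ⟨fun k => F k + if k = o then rest else 0, fun k => ?_, ?_, fun j k => ?_⟩
  · dsimp only
    split_ifs
    exacts [add_mem (hFmem k) hrest, add_mem (hFmem k) (zero_mem _)]
  · simpa [Finset.sum_add_distrib] using hsum
  · rw [Preadditive.comp_add, map_add, hF k (Finset.mem_univ k)]
    split_ifs <;> simp [hrest0]

end Measurement

namespace BankStrategy

variable {S : T.BankStrategy A}

lemma e_isSubcausal (i : S.ι) : T.IsSubcausal (S.e i) :=
  isSubcausal_effect_iff.2 ⟨S.e_mem i, S.e_le i⟩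

lemma num_verify_eq_one {χ : A ⟶ A ⊗ A} (hχ : T.IsSubcausal χ) (h : S.successProb χ = 1)
    (i : S.ι) : T.num (S.s i ≫ χ ≫ tensorEffect (S.e i) (S.e i)) = 1 := by
  have hle : ∀ j ∈ Finset.univ,
      S.p j * T.num (S.s j ≫ χ ≫ tensorEffect (S.e j) (S.e j)) ≤ S.p j :=
    fun j _ => mul_le_of_le_one_right (S.p_pos j).le (S.num_verify_le_one hχ j)
  have heq := (Finset.sum_eq_sum_iff_of_le hle).1 (h.trans S.p_sum.symm) i (Finset.mem_univ i)
  exact (mul_eq_left₀ (S.p_pos i).ne').1 heq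

lemma classicalEnsemble_of_measurement {κ : Type*} [Fintype κ] [DecidableEq κ]
    {t : κ → (𝟙_ C ⟶ A)} {f : κ → (A ⟶ 𝟙_ C)} (ht : ∀ k, T.IsCausal (t k))
    (hf : ∀ k, f k ∈ T.cone A (𝟙_ C)) (hsum : ∑ k, f k = T.discard A)
    (htf : ∀ j k, T.num (t j ≫ f k) = if j = k then 1 else 0)
    (hS : ∀ i, S.s i ∈ convexHull ℝ (Set.range t)) : S.ClassicalEnsemble := by
  let ε := (Fintype.equivFin κ).symm
  refine ⟨_, t ∘ ε, f ∘ ε, fun _ => ht _, fun _ => hf _, ?_, fun j k => ?_, ?_⟩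
  · rw [← hsum, ← ε.sum_comp]
    rfl
  · simpa only [Function.comp_apply, ε.injective.eq_iff] using htf (ε j) (ε k)
  · rwa [ε.surjective.range_comp]

lemma VerificationSharp.classicalEnsemble (hS : S.VerificationSharp) (h : 1 ≤ S.alpha) :
    S.ClassicalEnsemble := by
  classical
  obtain ⟨χ, hχ, hχα⟩ := S.exists_successProb_eq_alpha
  have hperfect : S.successProb χ = 1 := (S.successProb_le_one hχ).antisymm (hχα ▸ h)
  have : Nonempty S.ι := not_isEmpty_iff.1 fun _ => by simpa using S.p_sum
  have hcausal (k : Set.range S.s) : T.IsCausal (k : 𝟙_ C ⟶ A) := by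
    obtain ⟨_, i, rfl⟩ := k
    exact S.s_causal i
  have hclone (k : Set.range S.s) : T.Clones χ (k : 𝟙_ C ⟶ A) := by
    obtain ⟨_, i, rfl⟩ := k
    exact IsSharp.clones hχ (S.s_causal i) (e_isSubcausal i) (hS i)
      (num_verify_eq_one hχ hperfect i)
  have hsep (k : Set.range S.s) : ∃ g : A ⟶ 𝟙_ C, T.IsSubcausal g ∧
      T.num ((k : 𝟙_ C ⟶ A) ≫ g) = 1 ∧
      ∀ j : Set.range S.s, j ≠ k → T.num ((j : 𝟙_ C ⟶ A) ≫ g) = 0 := by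
    obtain ⟨_, i, rfl⟩ := k
    exact exists_separating_effect hχ hcausal hclone ⟨_, i, rfl⟩ (e_isSubcausal i) (S.accept i)
      fun j hj hone => hj (Subtype.ext ((hS i j (hcausal j).isSubcausal).1 hone))
  choose g hg hgself hgother using hsep
  obtain ⟨f, hf, hsum, htf⟩ := exists_measurement hχ hcausal hclone hg fun j k => by
    split_ifs with hjk
    exacts [hjk ▸ hgself k, hgother k j hjk]
  refine classicalEnsemble_of_measurement hcausal hf hsum htf fun i => ?_
  rw [Subtype.range_coe]
  exact subset_convexHull ℝ _ (Set.mem_range_self i)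

lemma VerificationSharp.alpha_lt_one (hS : S.VerificationSharp) (h : ¬ S.ClassicalEnsemble) :
    S.alpha < 1 :=
  not_le.1 fun hα => h (hS.classicalEnsemble hα)

end BankStrategy

lemma convex_causalStates (A : C) : Convex ℝ (T.causalStates A) := by
  intro s hs t ht a b ha hb hab
  refine ⟨add_mem (PointedCone.smul_mem _ ha hs.1) (PointedCone.smul_mem _ hb ht.1), ?_⟩
  rw [Preadditive.add_comp, Linear.smul_comp, Linear.smul_comp, hs.2, ht.2, ← add_smul, hab,
    one_smul]

lemma NoRestriction.exists_effect_of_nonneg_on_causalStates (hNR : T.NoRestriction)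
    (φ : (𝟙_ C ⟶ A) →ₗ[ℝ] ℝ) (hφ : ∀ s ∈ T.causalStates A, 0 ≤ φ s) :
    ∃ e ∈ T.cone A (𝟙_ C), ∀ s, T.num (s ≫ e) = φ s := by
  refine hNR A φ fun s hs => ?_
  obtain ⟨t, ht, hsmul⟩ := exists_eq_smul_isCausal hs
  rw [hsmul, map_smul]
  exact mul_nonneg (num_nonneg hs (T.discard_mem A)) (hφ t ht)

/-- If the functional `l` exposes `s`, then `l s - l` vanishes among the causal states only at `s`,
so a small multiple of it can serve as the effect of rejection. -/
lemma NoRestriction.exists_isSharp (hNR : T.NoRestriction) {s : 𝟙_ C ⟶ A}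
    (hs : s ∈ (T.causalStates A).exposedPoints ℝ) :
    ∃ e : A ⟶ 𝟙_ C, T.IsSubcausal e ∧ T.IsSharp e s := by
  obtain ⟨hsc, l, hl⟩ := hs
  obtain ⟨f, hf, hfl⟩ := hNR.exists_effect_of_nonneg_on_causalStates
    (l s • (T.pairing A).flip (T.discard A) - l.toLinearMap) fun t ht => by
      simpa [IsCausal.num_discard ht] using (hl t ht).1
  have hfs {t : 𝟙_ C ⟶ A} (ht : T.num (t ≫ T.discard A) = 1) : T.num (t ≫ f) = l s - l t := by
    simp [hfl, ht]
  obtain ⟨r, hr, hrf⟩ := T.exists_pos_discard_sub_smul_mem hf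
  have hrej : r • f ∈ T.cone A (𝟙_ C) := PointedCone.smul_mem _ hr.le hf
  refine ⟨T.discard A - r • f, isSubcausal_effect_iff.2 ⟨hrf, T.le_iff.2 (by simpa using hrej)⟩,
    fun t ht => ⟨fun haccept => ?_, fun h => ?_⟩⟩
  · have hrej0 := num_nonneg ht.1 hrej
    have hd1 := ht.num_comp_le_one (discard_isSubcausal A)
    rw [Preadditive.comp_sub, map_sub] at haccept
    have hd : T.num (t ≫ T.discard A) = 1 := by linarith
    have hzero : r * T.num (t ≫ f) = 0 := by
      rw [← smul_eq_mul, ← map_smul, ← Linear.comp_smul]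
      linarith
    rw [hfs hd, mul_eq_zero, sub_eq_zero] at hzero
    exact (hl t (isCausal_of_num_discard ht.1 hd)).2 (hzero.resolve_left hr.ne').le
  · have hd := IsCausal.num_discard hsc
    rw [h, Preadditive.comp_sub, map_sub, Linear.comp_smul, map_smul, hfs hd, hd, sub_self,
      smul_zero, sub_zero]

lemma linearIndependent_of_distinguishable {κ : Type*} [Finite κ] [DecidableEq κ]
    {t : κ → (𝟙_ C ⟶ A)} {f : κ → (A ⟶ 𝟙_ C)}
    (h : ∀ j k, T.num (t j ≫ f k) = if j = k then 1 else 0) : LinearIndependent ℝ t := by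
  have := Fintype.ofFinite κ
  rw [Fintype.linearIndependent_iff]
  intro c hc k
  simpa [h] using congrArg ((T.pairing A).flip (f k)) hc

/-- An exposed state is extreme, so if it lies in a simplex it is one of the vertices. -/
lemma BankStrategy.ClassicalEnsemble.linearIndependent {S : T.BankStrategy A}
    (hS : S.ClassicalEnsemble) (hexp : ∀ i, S.s i ∈ (T.causalStates A).exposedPoints ℝ)
    (hinj : Function.Injective S.s) : LinearIndependent ℝ S.s := by
  obtain ⟨n, t, f, ht, -, -, htf, hconv⟩ := hS
  have hvertex (i : S.ι) : S.s i ∈ Set.range t :=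
    extremePoints_convexHull_subset <| inter_extremePoints_subset_extremePoints_of_subset
      (convexHull_min (Set.range_subset_iff.2 ht) (convex_causalStates A))
      ⟨hconv i, exposedPoints_subset_extremePoints (hexp i)⟩
  choose vertex hvertex using hvertex
  have hcomp : t ∘ vertex = S.s := funext hvertex
  rw [← hcomp] at hinj ⊢
  exact (linearIndependent_of_distinguishable htf).comp vertex hinj.of_comp

/-- The bank strategy that prepares the states `s i` with equal probabilities and verifies them by
the effects `e i`. -/
noncomputable def BankStrategy.uniform {ι : Type} [Fintype ι] [Nonempty ι] (s : ι → (𝟙_ C ⟶ A))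
    (e : ι → (A ⟶ 𝟙_ C)) (hs : ∀ i, T.IsCausal (s i)) (he : ∀ i, T.IsSubcausal (e i))
    (hse : ∀ i, T.num (s i ≫ e i) = 1) : T.BankStrategy A where
  ι := ι
  p := fun _ => (Fintype.card ι : ℝ)⁻¹
  s := s
  e := e
  p_pos := fun _ => inv_pos.2 (Nat.cast_pos.2 Fintype.card_pos)
  p_sum := by simp
  s_causal := hs
  e_mem := fun i => (he i).1
  e_le := fun i => (isSubcausal_effect_iff.1 (he i)).2
  accept := hse

lemma NoRestriction.linearIndependent_of_classicalEnsemble (hNR : T.NoRestriction)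
    (hcl : ∀ S : T.BankStrategy A, S.VerificationSharp → S.ClassicalEnsemble)
    {ι : Type} [Finite ι] {s : ι → (𝟙_ C ⟶ A)} (hs : ∀ i, s i ∈ (T.causalStates A).exposedPoints ℝ)
    (hinj : Function.Injective s) : LinearIndependent ℝ s := by
  cases isEmpty_or_nonempty ι
  · exact linearIndependent_empty_type
  have := Fintype.ofFinite ι
  choose e he hsharp using fun i => hNR.exists_isSharp (hs i)
  let S : T.BankStrategy A := .uniform s e (fun i => (hs i).1) he fun i =>
    (hsharp i _ (IsCausal.isSubcausal (hs i).1)).2 rfl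
  exact (hcl S hsharp).linearIndependent hs hinj

lemma isClassicalSystem_of_linearIndependent_exposedPoints
    (h : LinearIndependent ℝ
      (Subtype.val : (T.causalStates A).exposedPoints ℝ → (𝟙_ C ⟶ A))) :
    T.IsClassicalSystem A := by
  have := T.finite (𝟙_ C) A
  have := T.t2Space_hom (𝟙_ C) A
  have : Finite ((T.causalStates A).exposedPoints ℝ) := h.finite
  let ε := (Finite.equivFin ((T.causalStates A).exposedPoints ℝ)).symm
  refine ⟨_, Subtype.val ∘ ε, (h.comp _ ε.injective).affineIndependent, ?_⟩
  rw [ε.surjective.range_comp, Subtype.range_coe]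
  exact (subset_convexHull_exposedPoints (isCompact_causalStates A) (Set.toFinite _)).antisymm
    (convexHull_min exposedPoints_subset (convex_causalStates A))

lemma NoRestriction.exists_not_classicalEnsemble (hNR : T.NoRestriction)
    (hA : ¬ T.IsClassicalSystem A) :
    ∃ S : T.BankStrategy A, S.VerificationSharp ∧ ¬ S.ClassicalEnsemble := by
  by_contra! hcl
  refine hA (isClassicalSystem_of_linearIndependent_exposedPoints ?_)
  rw [linearIndependent_iff_finset_linearIndependent]
  intro P
  rw [← linearIndependent_equiv P.equivFin.symm]
  exact hNR.linearIndependent_of_classicalEnsemble hcl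
    (fun i => (P.equivFin.symm i).1.2)
    ((Subtype.val_injective.comp Subtype.val_injective).comp P.equivFin.symm.injective)

lemma NonClassical.snc (hT : T.NonClassical) (hNR : T.NoRestriction) : T.SNC := by
  obtain ⟨A, hA⟩ := hT
  obtain ⟨S, hS, hcl⟩ := hNR.exists_not_classicalEnsemble hA
  exact S.snc_of_alpha_lt_one hNR (hS.alpha_lt_one hcl)

end GPT

theorem mainTheorem6_general {C : Type u} [Category.{v} C] [Preadditive C] [Linear ℝ C]
    [MonoidalCategory C] [MonoidalPreadditive C] [MonoidalLinear ℝ C] [SymmetricCategory C]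
    (T : GPT C) (hNR : T.NoRestriction) :
    (T.NonClassical → T.SNC) ∧ ∀ {A : C} (S : T.BankStrategy A),
      (S.VerificationSharp → ¬ S.ClassicalEnsemble → S.alpha < 1) ∧
        ∀ n : ℕ, (S.copies n).alpha ≤ S.alpha ^ (n + 1) :=
  ⟨fun hT => hT.snc hNR, fun S => ⟨fun hS hcl => hS.alpha_lt_one hcl, S.alpha_copies_le hNR⟩⟩

theorem mainTheorem6 {C : Type u} [Category.{v} C] [Preadditive C] [Linear ℝ C]
    [MonoidalCategory C] [MonoidalPreadditive C] [MonoidalLinear ℝ C] [SymmetricCategory C]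
    (T : GPT C) (hT : T.NonClassical) (hNR : T.NoRestriction) (hTL : T.TomographicLocality)
    {A : C} (S : T.BankStrategy A) (hS : S.VerificationSharp) :
    T.SNC ∧
      (¬ S.ClassicalEnsemble →
        S.alpha < 1 ∧ ∀ n : ℕ, (S.copies n).alpha ≤ S.alpha ^ (n + 1)) := by
  obtain ⟨hsnc, hstrategy⟩ := mainTheorem6_general T hNR
  exact ⟨hsnc hT, fun hcl => ⟨(hstrategy S).1 hS hcl, (hstrategy S).2⟩⟩
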